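/- Let $0<\alpha<1/3$, $\beta\ge 1$ and $d>0$. Put $\theta_\beta=\arctan(1/\beta^{1/2})$ (the unique $\theta\in(0,\pi/2)$ with $\beta^{1/2}\sin\theta-\cos\theta=0$), $$\Omega_\beta=\{(\theta,W)\in\mathbf R^2 : 0<\theta<\pi/2,\ (\theta,W)\ne(\theta_\beta,0)\},$$ $$Q(\theta,W)=\frac{d^2}{\beta}\left(\beta^{1/2}\sin\theta-\cos\theta\right)^2+W^2 ,$$ and consider in $\Omega_\beta$ the system $$\dot\theta=\frac{\alpha\beta^{1/2}W}{Q(\theta,W)^{3/2}},\qquad \dot W=\frac{\beta^{3/2}\sin\theta-\cos\theta}{d\sin\theta\cos\theta}-\frac{\alpha d^2(\sin\theta+\beta^{1/2}\cos\theta)(\beta^{1/2}\sin\theta-\cos\theta)}{\beta^{1/2}\,Q(\theta,W)^{3/2}},$$ with initial data $(\theta(0),W(0))=(\theta_0,W_0)\in\Omega_\beta$. (It describes two coaxial circular vortex filaments with vorticity strengths of the same sign and ratio $\beta$.) It is a Hamiltonian system with Hamiltonian $$\mathcal H(\theta,W)=\frac1{2d}\log\left(\frac{(1-\sin\theta)^{\beta^{3/2}}(1-\cos\theta)}{(1+\sin\theta)^{\beta^{3/2}}(1+\cos\theta)}\right)-\frac{\alpha\beta^{1/2}}{Q(\theta,W)^{1/2}}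 .$$ Then the system has exactly two equilibrium points in $\Omega_\beta$, namely $(\theta_*,0)$ and $(\theta_{**},0)$ with $0<\theta_*<\theta_\beta<\theta_{**}<\pi/2$. Moreover, for every $(\theta_0,W_0)\in\Omega_\beta$ there is a unique solution in $\Omega_\beta$, defined for all $t\in\mathbf R$, with initial data $(\theta_0,W_0)$, and the following are equivalent: (i) this solution is a leapfrogging solution, that is, its orbit is a closed orbit (it is periodic and not constant) revolving around the point $(\theta_\beta,0)$ (the point lies in the interior of the closed curve); (ii) $\theta_0\in(\theta_*,\theta_{**})$ and $\mathcal H(\theta_0,W_0)<\min\{\mathcal H(\theta_*,0),\mathcal H(\theta_{**},0)\}$. -/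

import Mathlib

noncomputable section

namespace FilamentPair

/-- The angle at which the two circular filaments have equal radii: the unique `θ ∈ (0, π/2)`
with `√β sin θ - cos θ = 0`. -/
def thetaB (β : ℝ) : ℝ := Real.arctan (1 / √β)

/-- The phase space: the strip `0 < θ < π/2`, `W ∈ ℝ`, without the point `(θ_β, 0)`, at which
the filaments overlap. -/
def Omega (β : ℝ) : Set (ℝ × ℝ) :=
  {p | 0 < p.1 ∧ p.1 < Real.pi / 2 ∧ p ≠ (thetaB β, 0)}

/-- The squared distance `(d² / β) (√β sin θ - cos θ)² + W²` of the two filaments. -/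
def distSq (d β θ W : ℝ) : ℝ :=
  d ^ 2 / β * (√β * Real.sin θ - Real.cos θ) ^ 2 + W ^ 2

/-- Right-hand side of the equation for `θ`. -/
def F1 (α β d θ W : ℝ) : ℝ :=
  α * √β * W / distSq d β θ W ^ (3 / 2 : ℝ)

/-- Right-hand side of the equation for `W`. -/
def F2 (α β d θ W : ℝ) : ℝ :=
  (β ^ (3 / 2 : ℝ) * Real.sin θ - Real.cos θ) / (d * Real.sin θ * Real.cos θ)
    - α * d ^ 2 * (Real.sin θ + √β * Real.cos θ) * (√β * Real.sin θ - Real.cos θ)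
        / (√β * distSq d β θ W ^ (3 / 2 : ℝ))

/-- The Hamiltonian. -/
def Ham (α β d θ W : ℝ) : ℝ :=
  1 / (2 * d) * Real.log
      (((1 - Real.sin θ) ^ (β ^ (3 / 2 : ℝ)) * (1 - Real.cos θ))
        / ((1 + Real.sin θ) ^ (β ^ (3 / 2 : ℝ)) * (1 + Real.cos θ)))
    - α * √β / √(distSq d β θ W)

/-- The equilibrium points of the system in the phase space. -/
def equilibria (α β d : ℝ) : Set (ℝ × ℝ) :=
  {p | p ∈ Omega β ∧ F1 α β d p.1 p.2 = 0 ∧ F2 α β d p.1 p.2 = 0}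

/-- `γ = (θ, W)` is a time-global solution, in the phase space, of
`θ' = F1 (θ, W)`, `W' = F2 (θ, W)` with initial data `p₀`. -/
structure IsSolution (α β d : ℝ) (p₀ : ℝ × ℝ) (γ : ℝ → ℝ × ℝ) : Prop where
  init : γ 0 = p₀
  mem_Omega : ∀ t, γ t ∈ Omega β
  hasDerivAt_fst : ∀ t, HasDerivAt (fun s => (γ s).1) (F1 α β d (γ t).1 (γ t).2) t
  hasDerivAt_snd : ∀ t, HasDerivAt (fun s => (γ s).2) (F2 α β d (γ t).1 (γ t).2) t

/-- The trajectory `γ` is a closed orbit: it is periodic and not a rest point. -/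
def IsClosedOrbit (γ : ℝ → ℝ × ℝ) : Prop :=
  (∃ T : ℝ, 0 < T ∧ Function.Periodic γ T) ∧ ∃ s t, γ s ≠ γ t

/-- The point `c` lies in the interior of the closed curve `γ`: it is not on the curve, and its
connected component in the complement of the curve in the plane is bounded. -/
def Encloses (γ : ℝ → ℝ × ℝ) (c : ℝ × ℝ) : Prop :=
  c ∉ Set.range γ ∧ Bornology.IsBounded (connectedComponentIn (Set.range γ)ᶜ c)

/-- A leapfrogging trajectory: a closed orbit revolving around `(θ_β, 0)`. -/
def IsLeapfrogging (β : ℝ) (γ : ℝ → ℝ × ℝ) : Prop :=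
  IsClosedOrbit γ ∧ Encloses γ (thetaB β, 0)

end FilamentPair

end

/-!
The system is `θ' = ∂H/∂W`, `W' = -∂H/∂θ` for `H = pot θ - α √β / r`, where
`r ^ 2 = sep θ ^ 2 + W ^ 2` is `distSq`, the function `sep` is strictly increasing with zero `θ_β`,
and `pot` is concave, negative, and tends to `-∞` at `0` and `π/2`.

*Equilibria.* They lie on the axis `W = 0`, where `sep ^ 2 + sepDeriv ^ 2` being constant makes
`∂H/∂θ` strictly decreasing on either side of `θ_β`. So `θ ↦ H(θ, 0)` has exactly one critical
point on each side, its maximum there (`exists_isCriticalPair`, `IsCriticalPair.equilibria_eq`).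

*Global solutions.* Energy is conserved, and as `pot < 0` an energy level keeps `θ` away from `0`
and `π/2`, keeps `r` away from `0`, and bounds the speed of `W`. Hence a solution remains in a
compact part of the phase space during any bounded time interval (`exists_isSolution`). The same
bounds hold for the field multiplied by any cutoff with values in `[0, 1]`, which still conserves
energy; so the solution of a globally Lipschitz truncation of the field already solves the
original system (`exists_global_of_apriori`).

*Leapfrogging implies the energy condition.* A curve around `(θ_β, 0)` meets the axis on both
sides of that point. There the energy is `H(θ, 0)`, which is less than the maximum on that side
unless the orbit is an equilibrium. Since `H(θ, W) ≥ H(θ, 0)`, orbits of energy less than both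
maxima never cross the lines `θ = θ*` and `θ = θ**`.

*The energy condition implies leapfrogging.* The orbit stays between the two lines. It meets the
axis at arbitrarily late times, since otherwise `θ` would be eventually monotone and the orbit
would converge to an equilibrium of its own energy (`IsCriticalPair.exists_snd_eq_zero`). The
system is reversible under `W ↦ -W`, so two meetings with the axis make the orbit periodic
(`IsSolution.periodic_of_snd_eq_zero`). At the extreme values of `θ` the orbit is on the axis, one
extremum on each side of `θ_β`; by the intermediate value theorem and reflection the orbit fills
its energy level between the lines (`IsCriticalPair.isClosedOrbit_and_subset_range`). The region
of smaller energy between the lines is then a bounded neighbourhood of `(θ_β, 0)` whose boundary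
lies in the orbit (`IsCriticalPair.encloses`).
-/

open Set Filter Topology Metric
open scoped NNReal ContDiff Manifold

namespace FilamentPair

/-! ### Global solutions of autonomous differential equations -/

section ODE

variable {E : Type*} [NormedAddCommGroup E] [NormedSpace ℝ E] [FiniteDimensional ℝ E]

/-- A `C¹` vector field on an open set can be cut off outside a compact subset so that it becomes
globally bounded and globally Lipschitz. -/
theorem exists_lipschitz_cutoff {U K : Set E} (hU : IsOpen U) (hK : IsCompact K) (hKU : K ⊆ U)
    {F : E → E} (hF : ContDiffOn ℝ 1 F U) :
    ∃ χ : E → ℝ, (∀ x, χ x ∈ Icc 0 1) ∧ (∀ x ∈ K, χ x = 1) ∧ (∀ x ∉ U, χ x = 0) ∧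
      (∃ C : ℝ≥0, LipschitzWith C fun x => χ x • F x) ∧ ∃ M : ℝ≥0, ∀ x, ‖χ x • F x‖ ≤ M := by
  obtain ⟨L, hL, hKL, hLU⟩ := exists_compact_between hK hU hKU
  obtain ⟨χ, hχ, hr, hs, h1⟩ := exists_contMDiff_support_eq_eq_one_iff (n := 1) 𝓘(ℝ, E)
    isOpen_interior hK.isClosed hKL
  have hsupp : tsupport χ ⊆ L := by
    rw [tsupport, hs]; exact closure_minimal interior_subset hL.isClosed
  have hsuppF : tsupport (fun x => χ x • F x) ⊆ tsupport χ :=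
    closure_mono (Function.support_smul_subset_left χ F)
  have hc : HasCompactSupport fun x => χ x • F x :=
    hL.of_isClosed_subset isClosed_closure (hsuppF.trans hsupp)
  have hd : ContDiff ℝ 1 fun x => χ x • F x := by
    refine (contMDiff_of_tsupport (I := 𝓘(ℝ, E)) (I' := 𝓘(ℝ, E)) fun x hx => ?_).contDiff
    exact (hχ.contDiff.contDiffAt.smul
      (hF.contDiffAt (hU.mem_nhds (hLU (hsupp (hsuppF hx)))))).contMDiffAt
  obtain ⟨M, hM⟩ := hc.exists_bound_of_continuous hd.continuous
  refine ⟨χ, fun x => hr (mem_range_self x), fun x hx => (h1 x).1 hx, fun x hx => ?_,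
    ContDiff.lipschitzWith_of_hasCompactSupport hc hd one_ne_zero,
    ⟨M.toNNReal, fun x => (hM x).trans (Real.le_coe_toNNReal M)⟩⟩
  by_contra h
  exact hx (hLU (interior_subset (hs ▸ (Function.mem_support.2 h))))

/-- Two trajectories of a `C¹` vector field on an open set that meet at one time agree. -/
theorem eqOn_of_hasDerivAt {U : Set E} (hU : IsOpen U) {F : E → E} (hF : ContDiffOn ℝ 1 F U)
    {γ₁ γ₂ : ℝ → E} {a b t₀ : ℝ} (ht₀ : t₀ ∈ Ioo a b)
    (h₁ : ∀ t ∈ Ioo a b, HasDerivAt γ₁ (F (γ₁ t)) t ∧ γ₁ t ∈ U)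
    (h₂ : ∀ t ∈ Ioo a b, HasDerivAt γ₂ (F (γ₂ t)) t ∧ γ₂ t ∈ U)
    (h : γ₁ t₀ = γ₂ t₀) : EqOn γ₁ γ₂ (Ioo a b) := by
  intro t ht
  obtain ⟨a', ha, ha'⟩ := exists_between (lt_min ht.1 ht₀.1)
  obtain ⟨b', hb', hb⟩ := exists_between (max_lt ht.2 ht₀.2)
  obtain ⟨hat, hat₀⟩ := lt_min_iff.1 ha'
  obtain ⟨hbt, hbt₀⟩ := max_lt_iff.1 hb'
  have hsub : Icc a' b' ⊆ Ioo a b := Icc_subset_Ioo ha hb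
  have hK : IsCompact (γ₁ '' Icc a' b' ∪ γ₂ '' Icc a' b') :=
    (isCompact_Icc.image_of_continuousOn
      fun s hs => (h₁ s (hsub hs)).1.continuousAt.continuousWithinAt).union
    (isCompact_Icc.image_of_continuousOn
      fun s hs => (h₂ s (hsub hs)).1.continuousAt.continuousWithinAt)
  have hKU : γ₁ '' Icc a' b' ∪ γ₂ '' Icc a' b' ⊆ U := by
    rintro _ (⟨s, hs, rfl⟩ | ⟨s, hs, rfl⟩)
    exacts [(h₁ s (hsub hs)).2, (h₂ s (hsub hs)).2]
  obtain ⟨χ, -, hχ, -, ⟨C, hC⟩, -⟩ := exists_lipschitz_cutoff hU hK hKU hF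
  refine ODE_solution_unique_of_mem_Ioo (v := fun _ x => χ x • F x) (s := fun _ => univ)
    (fun _ _ => hC.lipschitzOnWith) ⟨hat₀, hbt₀⟩ (fun s hs => ⟨?_, trivial⟩)
    (fun s hs => ⟨?_, trivial⟩) h ⟨hat, hbt⟩
  · have hs' := Ioo_subset_Icc_self hs
    rw [hχ _ (Or.inl ⟨s, hs', rfl⟩), one_smul]
    exact (h₁ s (hsub hs')).1
  · have hs' := Ioo_subset_Icc_self hs
    rw [hχ _ (Or.inr ⟨s, hs', rfl⟩), one_smul]
    exact (h₂ s (hsub hs')).1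

/-- A bounded Lipschitz vector field has trajectories on arbitrarily long time intervals. -/
theorem exists_hasDerivAt_of_bounded {G : E → E} {C M : ℝ≥0} (hC : LipschitzWith C G)
    (hM : ∀ x, ‖G x‖ ≤ M) (x₀ : E) {T : ℝ} (hT : 0 < T) :
    ∃ γ : ℝ → E, γ 0 = x₀ ∧ ∀ t ∈ Ioo (-T) T, HasDerivAt γ (G (γ t)) t := by
  have h0 : (0 : ℝ) ∈ Icc (-T) T := ⟨by linarith, hT.le⟩
  have hPL : IsPicardLindelof (fun _ => G) (⟨0, h0⟩ : Icc (-T) T) x₀ (M * T.toNNReal) 0 M C :=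
    IsPicardLindelof.of_time_independent (fun x _ => hM x) hC.lipschitzOnWith
      (by simp [Real.coe_toNNReal T hT.le])
  obtain ⟨γ, h₀, h⟩ := hPL.exists_eq_forall_mem_Icc_hasDerivWithinAt₀
  exact ⟨γ, h₀, fun t ht => (h t (Ioo_subset_Icc_self ht)).hasDerivAt (Icc_mem_nhds ht.1 ht.2)⟩

/-- Global existence from an a priori bound: if, for each time `T`, the trajectories on `(-T, T)` of
all the fields `χ • F` with `0 ≤ χ ≤ 1` starting at `x₀` stay in one compact subset of `U`, then
the trajectory of `F` through `x₀` exists for all times. -/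
theorem exists_global_of_apriori {U : Set E} (hU : IsOpen U) {F : E → E}
    (hF : ContDiffOn ℝ 1 F U) {x₀ : E} (hx₀ : x₀ ∈ U)
    (hK : ∀ T : ℝ, 0 < T → ∃ K : Set E, IsCompact K ∧ K ⊆ U ∧
      ∀ (χ : E → ℝ) (γ : ℝ → E), (∀ x, χ x ∈ Icc 0 1) → γ 0 = x₀ →
        (∀ t ∈ Ioo (-T) T, HasDerivAt γ (χ (γ t) • F (γ t)) t) →
        (∀ t ∈ Ioo (-T) T, γ t ∈ U) → ∀ t ∈ Ioo (-T) T, γ t ∈ K) :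
    ∃ γ : ℝ → E, γ 0 = x₀ ∧ ∀ t, HasDerivAt γ (F (γ t)) t ∧ γ t ∈ U := by
  have key : ∀ n : ℕ, ∃ γ : ℝ → E, γ 0 = x₀ ∧
      ∀ t ∈ Ioo (-(n + 1 : ℝ)) (n + 1), HasDerivAt γ (F (γ t)) t ∧ γ t ∈ U := by
    intro n
    have hT : (0 : ℝ) < n + 1 := by positivity
    obtain ⟨K, hKc, hKU, hγK⟩ := hK (n + 1) hT
    obtain ⟨χ, hχI, hχ1, hχ0, ⟨C, hC⟩, M, hM⟩ := exists_lipschitz_cutoff hU hKc hKU hF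
    obtain ⟨γ, h0, hγ⟩ := exists_hasDerivAt_of_bounded hC hM x₀ hT
    have hmemU : ∀ t ∈ Ioo (-(n + 1 : ℝ)) (n + 1), γ t ∈ U := by
      -- Points outside `U` are rest points of the field that has been cut off.
      intro t ht
      by_contra hUt
      have hconst := ODE_solution_unique_of_mem_Ioo (v := fun _ x => χ x • F x)
        (s := fun _ => univ) (fun _ _ => hC.lipschitzOnWith) ht
        (fun s hs => ⟨hγ s hs, trivial⟩)
        (g := fun _ => γ t) (fun s _ => ⟨by
          simpa [hχ0 _ hUt] using hasDerivAt_const s (γ t), trivial⟩) rfl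
        (show (0 : ℝ) ∈ Ioo _ _ from ⟨by linarith, hT⟩)
      exact hUt ((show x₀ = γ t from h0.symm.trans hconst) ▸ hx₀)
    have hmemK := hγK χ γ hχI h0 hγ hmemU
    refine ⟨γ, h0, fun t ht => ⟨?_, hmemU t ht⟩⟩
    have := hγ t ht
    rwa [hχ1 _ (hmemK t ht), one_smul] at this
  choose g hg0 hg using key
  have hmono : ∀ m n : ℕ, m ≤ n → EqOn (g m) (g n) (Ioo (-(m + 1 : ℝ)) (m + 1)) := by
    intro m n hmn
    have hmn' : (m : ℝ) ≤ n := by exact_mod_cast hmn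
    refine eqOn_of_hasDerivAt hU hF (t₀ := 0) ⟨?_, by positivity⟩ (hg m)
      (fun t ht => hg n t ⟨by linarith [ht.1], by linarith [ht.2]⟩) (by rw [hg0, hg0])
    have : (0 : ℝ) ≤ m := m.cast_nonneg
    linarith
  have hmem : ∀ t : ℝ, t ∈ Ioo (-((⌈|t|⌉₊ : ℝ) + 1)) (⌈|t|⌉₊ + 1) := fun t => by
    have h1 := Nat.le_ceil |t|
    constructor <;> linarith [neg_abs_le t, le_abs_self t]
  refine ⟨fun t => g ⌈|t|⌉₊ t, by simp [hg0], fun t => ⟨?_, (hg _ t (hmem t)).2⟩⟩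
  refine (hg _ t (hmem t)).1.congr_of_eventuallyEq ?_
  filter_upwards [isOpen_Ioo.mem_nhds (hmem t)] with s hs
  rcases le_total ⌈|s|⌉₊ ⌈|t|⌉₊ with h | h
  · exact hmono _ _ h (hmem s)
  · exact (hmono _ _ h hs).symm

/-- If a function converges at infinity and its derivative does too, the derivative tends to 0. -/
theorem eq_zero_of_tendsto_of_tendsto_deriv {f f' : ℝ → ℝ} {L m : ℝ}
    (hf : ∀ t, HasDerivAt f (f' t) t) (hL : Tendsto f atTop (𝓝 L))
    (hm : Tendsto f' atTop (𝓝 m)) : m = 0 := by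
  have hmvt : ∀ t : ℝ, ∃ s, t < s ∧ f' s = f (t + 1) - f t := fun t => by
    obtain ⟨s, hs, h⟩ := exists_hasDerivAt_eq_slope f f' (show t < t + 1 by linarith)
      (fun s _ => (hf s).continuousAt.continuousWithinAt) (fun s _ => hf s)
    exact ⟨s, hs.1, by rw [h]; simp⟩
  choose σ hσ hσ' using hmvt
  have h1 : Tendsto (fun t => f' (σ t)) atTop (𝓝 m) :=
    hm.comp (tendsto_atTop_mono (fun t => (hσ t).le) tendsto_id)
  have h2 : Tendsto (fun t => f' (σ t)) atTop (𝓝 (L - L)) := by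
    simp_rw [hσ']
    exact (hL.comp (tendsto_atTop_add_const_right _ 1 tendsto_id)).sub hL
  simpa using tendsto_nhds_unique h1 h2

end ODE

/-! ### The Hamiltonian and the vector field -/

/-- The signed distance `(d / √β) (√β sin θ - cos θ)` of the filaments when `W = 0`. -/
noncomputable def sep (d β θ : ℝ) : ℝ := d / √β * (√β * Real.sin θ - Real.cos θ)

/-- The derivative of `sep`. -/
noncomputable def sepDeriv (d β θ : ℝ) : ℝ := d / √β * (√β * Real.cos θ + Real.sin θ)

/-- The part of the Hamiltonian that depends on `θ` only, on `(0, π/2)`. -/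
noncomputable def pot (d β θ : ℝ) : ℝ :=
  1 / (2 * d) * (β ^ (3 / 2 : ℝ) * (Real.log (1 - Real.sin θ) - Real.log (1 + Real.sin θ))
    + (Real.log (1 - Real.cos θ) - Real.log (1 + Real.cos θ)))

/-- The derivative of `pot`. -/
noncomputable def potDeriv (d β θ : ℝ) : ℝ :=
  1 / d * (1 / Real.sin θ - β ^ (3 / 2 : ℝ) / Real.cos θ)

section Calculus

variable {α β d θ W : ℝ}

theorem thetaB_pos (hβ : 0 < β) : 0 < thetaB β := by
  have := Real.sqrt_pos.2 hβ
  exact Real.arctan_pos.2 (by positivity)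

theorem thetaB_lt (β : ℝ) : thetaB β < Real.pi / 2 := Real.arctan_lt_pi_div_two _

theorem sin_pos_of_mem (hθ : θ ∈ Ioo 0 (Real.pi / 2)) : 0 < Real.sin θ :=
  Real.sin_pos_of_pos_of_lt_pi hθ.1 (by linarith [hθ.2, Real.pi_pos])

theorem cos_pos_of_mem (hθ : θ ∈ Ioo 0 (Real.pi / 2)) : 0 < Real.cos θ :=
  Real.cos_pos_of_mem_Ioo ⟨by linarith [hθ.1, Real.pi_pos], hθ.2⟩

theorem sin_lt_one_of_mem (hθ : θ ∈ Ioo 0 (Real.pi / 2)) : Real.sin θ < 1 := by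
  nlinarith [Real.sin_sq_add_cos_sq θ, cos_pos_of_mem hθ, sin_pos_of_mem hθ]

theorem cos_lt_one_of_mem (hθ : θ ∈ Ioo 0 (Real.pi / 2)) : Real.cos θ < 1 := by
  nlinarith [Real.sin_sq_add_cos_sq θ, cos_pos_of_mem hθ, sin_pos_of_mem hθ]

theorem sep_strictMonoOn (hβ : 0 < β) (hd : 0 < d) :
    StrictMonoOn (sep d β) (Icc 0 (Real.pi / 2)) := by
  intro x hx y hy hxy
  have h1 := Real.strictMonoOn_sin ⟨by linarith [hx.1, Real.pi_pos], hx.2⟩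
    ⟨by linarith [hy.1, Real.pi_pos], hy.2⟩ hxy
  have h2 := Real.strictAntiOn_cos ⟨hx.1, by linarith [hx.2, Real.pi_pos]⟩
    ⟨hy.1, by linarith [hy.2, Real.pi_pos]⟩ hxy
  have hb := Real.sqrt_pos.2 hβ
  have : √β * Real.sin x - Real.cos x < √β * Real.sin y - Real.cos y := by nlinarith
  exact mul_lt_mul_of_pos_left this (by positivity)

theorem sep_thetaB (hβ : 0 < β) : sep d β (thetaB β) = 0 := by
  have hb := Real.sqrt_pos.2 hβ
  have hc := cos_pos_of_mem ⟨thetaB_pos hβ, thetaB_lt β⟩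
  have ht : Real.tan (thetaB β) = 1 / √β := Real.tan_arctan _
  rw [Real.tan_eq_sin_div_cos, div_eq_div_iff hc.ne' hb.ne'] at ht
  rw [sep, show √β * Real.sin (thetaB β) - Real.cos (thetaB β) = 0 by linarith, mul_zero]

theorem sep_pos (hβ : 0 < β) (hd : 0 < d) (h : thetaB β < θ) (h' : θ ≤ Real.pi / 2) :
    0 < sep d β θ := by
  have hB := thetaB_pos hβ
  rw [← sep_thetaB (d := d) hβ]
  exact sep_strictMonoOn hβ hd ⟨hB.le, (thetaB_lt β).le⟩ ⟨(hB.trans h).le, h'⟩ h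

theorem sep_neg (hβ : 0 < β) (hd : 0 < d) (h : 0 ≤ θ) (h' : θ < thetaB β) :
    sep d β θ < 0 := by
  have hB := thetaB_lt β
  rw [← sep_thetaB (d := d) hβ]
  exact sep_strictMonoOn hβ hd ⟨h, (h'.trans hB).le⟩ ⟨(h.trans_lt h').le, hB.le⟩ h'

theorem sepDeriv_pos (hβ : 0 < β) (hd : 0 < d) (hθ : θ ∈ Ioo 0 (Real.pi / 2)) :
    0 < sepDeriv d β θ := by
  have h1 := sin_pos_of_mem hθ
  have h2 := cos_pos_of_mem hθ
  have hb := Real.sqrt_pos.2 hβ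
  unfold sepDeriv
  positivity

theorem sep_sq_add_sepDeriv_sq (hβ : 0 < β) :
    sep d β θ ^ 2 + sepDeriv d β θ ^ 2 = (d / √β) ^ 2 * (β + 1) := by
  rw [sep, sepDeriv, mul_pow, mul_pow, ← mul_add]
  congr 1
  linear_combination (Real.sin θ ^ 2 + Real.cos θ ^ 2) * Real.sq_sqrt hβ.le
    + (β + 1) * Real.sin_sq_add_cos_sq θ

theorem hasDerivAt_sep (d β θ : ℝ) : HasDerivAt (sep d β) (sepDeriv d β θ) θ := by
  have := (((Real.hasDerivAt_sin θ).const_mul (√β)).sub (Real.hasDerivAt_cos θ)).const_mul (d / √β)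
  exact this.congr_deriv (by rw [sepDeriv, sub_neg_eq_add])

theorem continuous_sep (d β : ℝ) : Continuous (sep d β) := by unfold sep; fun_prop

theorem distSq_eq (hβ : 0 < β) : distSq d β θ W = sep d β θ ^ 2 + W ^ 2 := by
  rw [distSq, sep, mul_pow, div_pow, Real.sq_sqrt hβ.le]

theorem distSq_nonneg (hβ : 0 < β) : 0 ≤ distSq d β θ W := by
  rw [distSq_eq hβ]; positivity

theorem mem_Ioo_of_mem_Omega (h : (θ, W) ∈ Omega β) : θ ∈ Ioo 0 (Real.pi / 2) := ⟨h.1, h.2.1⟩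

theorem sep_ne_zero (hβ : 0 < β) (hd : 0 < d) (hθ : θ ∈ Ioo 0 (Real.pi / 2))
    (h : θ ≠ thetaB β) : sep d β θ ≠ 0 := by
  rcases h.lt_or_gt with h | h
  · exact (sep_neg hβ hd hθ.1.le h).ne
  · exact (sep_pos hβ hd h hθ.2.le).ne'

theorem distSq_pos (hβ : 0 < β) (hd : 0 < d) (h : (θ, W) ∈ Omega β) : 0 < distSq d β θ W := by
  rw [distSq_eq hβ]
  by_cases hθ : θ = thetaB β
  · have hW : W ≠ 0 := fun hW => h.2.2 (by rw [hθ, hW])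
    positivity
  · have := sep_ne_zero hβ hd (mem_Ioo_of_mem_Omega h) hθ
    positivity

theorem isOpen_Omega (β : ℝ) : IsOpen (Omega β) := by
  have : Omega β = {p | 0 < p.1} ∩ ({p | p.1 < Real.pi / 2} ∩ {(thetaB β, 0)}ᶜ) := rfl
  rw [this]
  exact (isOpen_lt continuous_const continuous_fst).inter
    ((isOpen_lt continuous_fst continuous_const).inter isOpen_compl_singleton)

theorem rpow_three_halves {x : ℝ} (hx : 0 ≤ x) : x ^ (3 / 2 : ℝ) = √x ^ 3 := by
  rw [Real.sqrt_eq_rpow, ← Real.rpow_natCast, ← Real.rpow_mul hx]; norm_num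

theorem F1_eq (hβ : 0 < β) : F1 α β d θ W = α * √β * W / √(distSq d β θ W) ^ 3 := by
  rw [F1, rpow_three_halves (distSq_nonneg hβ)]

theorem F2_eq (hβ : 0 < β) (hd : 0 < d) (hθ : θ ∈ Ioo 0 (Real.pi / 2)) :
    F2 α β d θ W = -potDeriv d β θ
      - α * √β * (sep d β θ * sepDeriv d β θ) / √(distSq d β θ W) ^ 3 := by
  have h1 := (sin_pos_of_mem hθ).ne'
  have h2 := (cos_pos_of_mem hθ).ne'
  have hb := Real.sqrt_pos.2 hβ
  rw [F2, rpow_three_halves (x := distSq _ _ _ _) (distSq_nonneg hβ)]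
  congr 1
  · rw [potDeriv]; field_simp; ring
  · rw [mul_comm (√β), ← div_div]
    congr 1
    rw [sep, sepDeriv]; field_simp; ring

theorem Ham_eq (hθ : θ ∈ Ioo 0 (Real.pi / 2)) :
    Ham α β d θ W = pot d β θ - α * √β / √(distSq d β θ W) := by
  have h1 := sub_pos.2 (sin_lt_one_of_mem hθ)
  have h2 := sub_pos.2 (cos_lt_one_of_mem hθ)
  have h3 : 0 < 1 + Real.sin θ := by linarith [sin_pos_of_mem hθ]
  have h4 : 0 < 1 + Real.cos θ := by linarith [cos_pos_of_mem hθ]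
  have h5 := Real.rpow_pos_of_pos h1 (β ^ (3 / 2 : ℝ))
  have h6 := Real.rpow_pos_of_pos h3 (β ^ (3 / 2 : ℝ))
  rw [Ham, pot, Real.log_div (by positivity) (by positivity), Real.log_mul h5.ne' h2.ne',
    Real.log_mul h6.ne' h4.ne', Real.log_rpow h1, Real.log_rpow h3]
  congr 2
  ring

theorem hasDerivAt_pot (β : ℝ) (hd : 0 < d) (hθ : θ ∈ Ioo 0 (Real.pi / 2)) :
    HasDerivAt (pot d β) (potDeriv d β θ) θ := by
  have hs := sin_pos_of_mem hθ
  have hc := cos_pos_of_mem hθ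
  have h1 := sub_pos.2 (sin_lt_one_of_mem hθ)
  have h2 := sub_pos.2 (cos_lt_one_of_mem hθ)
  have h3 : 0 < 1 + Real.sin θ := by linarith
  have h4 : 0 < 1 + Real.cos θ := by linarith
  have e1 := ((Real.hasDerivAt_sin θ).const_sub 1).log h1.ne'
  have e2 := ((Real.hasDerivAt_sin θ).const_add 1).log h3.ne'
  have e3 := ((Real.hasDerivAt_cos θ).const_sub 1).log h2.ne'
  have e4 := ((Real.hasDerivAt_cos θ).const_add 1).log h4.ne'
  have := (((e1.sub e2).const_mul (β ^ (3 / 2 : ℝ))).add (e3.sub e4)).const_mul (1 / (2 * d))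
  refine this.congr_deriv ?_
  have k1 : -Real.cos θ / (1 - Real.sin θ) - Real.cos θ / (1 + Real.sin θ) = -2 / Real.cos θ := by
    field_simp
    linear_combination (-2 : ℝ) * Real.sin_sq_add_cos_sq θ
  have k2 : - -Real.sin θ / (1 - Real.cos θ) - -Real.sin θ / (1 + Real.cos θ)
      = 2 / Real.sin θ := by
    field_simp
    linear_combination (2 : ℝ) * Real.sin_sq_add_cos_sq θ
  rw [k1, k2, potDeriv]
  field_simp
  ring

/-- The chain rule for the Hamiltonian along a curve: `H_θ = -F2` and `H_W = F1`. -/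
theorem hasDerivAt_Ham_comp (hβ : 0 < β) (hd : 0 < d) {x y : ℝ → ℝ} {x' y' t : ℝ}
    (hmem : (x t, y t) ∈ Omega β) (hx : HasDerivAt x x' t) (hy : HasDerivAt y y' t) :
    HasDerivAt (fun s => Ham α β d (x s) (y s))
      (-F2 α β d (x t) (y t) * x' + F1 α β d (x t) (y t) * y') t := by
  have hθ := mem_Ioo_of_mem_Omega hmem
  have hQ := distSq_pos hβ hd hmem
  have hr := Real.sqrt_pos.2 hQ
  have hev : (fun s => Ham α β d (x s) (y s)) =ᶠ[𝓝 t]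
      fun s => pot d β (x s) - α * √β / √(sep d β (x s) ^ 2 + y s ^ 2) := by
    filter_upwards [hx.continuousAt.eventually_mem (Ioo_mem_nhds hθ.1 hθ.2)] with s hs
    rw [Ham_eq hs, distSq_eq hβ]
  refine HasDerivAt.congr_of_eventuallyEq ?_ hev
  have h1 := (hasDerivAt_pot β hd hθ).comp t hx
  have h2 := ((hasDerivAt_sep d β (x t)).comp t hx).pow 2
  have h3 := h2.add (hy.pow 2)
  rw [distSq_eq hβ] at hQ hr
  have h4 := (h3.sqrt hQ.ne').inv hr.ne'
  have := h1.sub (h4.const_mul (α * √β))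
  refine this.congr_deriv ?_
  rw [F1_eq hβ, F2_eq hβ hd hθ, distSq_eq hβ]
  simp only [Function.comp, Pi.add_apply, Pi.pow_apply]
  field_simp
  ring

theorem F1_neg (α β d θ W : ℝ) : F1 α β d θ (-W) = -F1 α β d θ W := by
  simp [F1, distSq, neg_div]

theorem F2_neg (α β d θ W : ℝ) : F2 α β d θ (-W) = F2 α β d θ W := by
  simp [F2, distSq]

theorem Omega_neg (h : (θ, W) ∈ Omega β) : (θ, -W) ∈ Omega β :=
  ⟨h.1, h.2.1, fun e => h.2.2 (by simpa using e)⟩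

/-- The vector field is `C¹` on the phase space. -/
theorem contDiffOn_field (α : ℝ) (hβ : 0 < β) (hd : 0 < d) :
    ContDiffOn ℝ 1 (fun p : ℝ × ℝ => (F1 α β d p.1 p.2, F2 α β d p.1 p.2)) (Omega β) := by
  have hb := Real.sqrt_pos.2 hβ
  have hQ : ContDiff ℝ 1 fun p : ℝ × ℝ => distSq d β p.1 p.2 := by
    unfold distSq
    exact (contDiff_const.mul (((contDiff_const.mul (Real.contDiff_sin.comp contDiff_fst)).sub
      (Real.contDiff_cos.comp contDiff_fst)).pow 2)).add (contDiff_snd.pow 2)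
  have hs : ContDiff ℝ 1 fun p : ℝ × ℝ => Real.sin p.1 := Real.contDiff_sin.comp contDiff_fst
  have hc : ContDiff ℝ 1 fun p : ℝ × ℝ => Real.cos p.1 := Real.contDiff_cos.comp contDiff_fst
  intro p hp
  have hp' : (p.1, p.2) ∈ Omega β := hp
  have hθ := mem_Ioo_of_mem_Omega hp'
  have h0 := distSq_pos hβ hd hp'
  have hs0 := sin_pos_of_mem hθ
  have hc0 := cos_pos_of_mem hθ
  have hR : ContDiffAt ℝ 1 (fun p : ℝ × ℝ => distSq d β p.1 p.2 ^ (3 / 2 : ℝ)) p :=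
    hQ.contDiffAt.rpow_const_of_ne h0.ne'
  have hR0 := Real.rpow_pos_of_pos h0 (3 / 2 : ℝ)
  refine ContDiffAt.contDiffWithinAt (ContDiffAt.prodMk ?_ ?_)
  · exact (contDiff_const.mul contDiff_snd).contDiffAt.div hR hR0.ne'
  · refine ContDiffAt.sub (ContDiffAt.div ?_ ?_ ?_) (ContDiffAt.div ?_ ?_ ?_)
    · exact ((contDiff_const.mul hs).sub hc).contDiffAt
    · exact ((contDiff_const.mul hs).mul hc).contDiffAt
    · positivity
    · exact ((contDiff_const.mul (hs.add (contDiff_const.mul hc))).mul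
        ((contDiff_const.mul hs).sub hc)).contDiffAt
    · exact contDiffAt_const.mul hR
    · positivity

end Calculus

/-! ### The two equilibria and the Hamiltonian on the axis `W = 0` -/

/-- `θs < θ_β < θss` are the critical points of `θ ↦ Ham θ 0`, together with the sign of the
derivative `-F2 θ 0` on the four intervals that they and `θ_β` cut out of `(0, π/2)`. -/
structure IsCriticalPair (α β d θs θss : ℝ) : Prop where
  pos : 0 < θs
  lt_thetaB : θs < thetaB β
  thetaB_lt : thetaB β < θss
  lt_pi_div_two : θss < Real.pi / 2
  left_eq : F2 α β d θs 0 = 0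
  right_eq : F2 α β d θss 0 = 0
  F2_neg_of_lt : ∀ θ ∈ Ioo 0 θs, F2 α β d θ 0 < 0
  F2_pos_of_gt : ∀ θ ∈ Ioo θs (thetaB β), 0 < F2 α β d θ 0
  F2_neg_of_lt' : ∀ θ ∈ Ioo (thetaB β) θss, F2 α β d θ 0 < 0
  F2_pos_of_gt' : ∀ θ ∈ Ioo θss (Real.pi / 2), 0 < F2 α β d θ 0

section Axis

variable {α β d θ W : ℝ}

theorem potDeriv_strictAntiOn (hβ : 0 < β) (hd : 0 < d) :
    StrictAntiOn (potDeriv d β) (Ioo 0 (Real.pi / 2)) := by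
  intro x hx y hy hxy
  have hs := Real.strictMonoOn_sin ⟨by linarith [hx.1, Real.pi_pos], hx.2.le⟩
    ⟨by linarith [hy.1, Real.pi_pos], hy.2.le⟩ hxy
  have hc := Real.strictAntiOn_cos ⟨hx.1.le, by linarith [hx.2, Real.pi_pos]⟩
    ⟨hy.1.le, by linarith [hy.2, Real.pi_pos]⟩ hxy
  have hp : 0 < β ^ (3 / 2 : ℝ) := Real.rpow_pos_of_pos hβ _
  have h1 := one_div_lt_one_div_of_lt (sin_pos_of_mem hx) hs
  have h2 := div_lt_div_of_pos_left hp (cos_pos_of_mem hy) hc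
  exact mul_lt_mul_of_pos_left (by linarith) (by positivity)

/-- Where the separation decreases in absolute value, the attraction grows: `sepDeriv / sep ^ 2`
is a decreasing function of `|sep|`, as `sep ^ 2 + sepDeriv ^ 2` is constant. -/
theorem sepDeriv_div_lt (hβ : 0 < β) (hd : 0 < d) {x y : ℝ} (hx : x ∈ Ioo 0 (Real.pi / 2))
    (hy : y ∈ Ioo 0 (Real.pi / 2)) (h0 : 0 < sep d β x ^ 2)
    (h : sep d β x ^ 2 < sep d β y ^ 2) :
    sepDeriv d β y / sep d β y ^ 2 < sepDeriv d β x / sep d β x ^ 2 := by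
  have h1 := sepDeriv_pos hβ hd hx
  have h2 := sepDeriv_pos hβ hd hy
  have h3 := (sep_sq_add_sepDeriv_sq (d := d) (θ := x) hβ).trans
    (sep_sq_add_sepDeriv_sq (d := d) (θ := y) hβ).symm
  have h4 : sepDeriv d β y < sepDeriv d β x := by nlinarith
  gcongr

theorem F2_axis_right (hβ : 0 < β) (hd : 0 < d) (h : θ ∈ Ioo (thetaB β) (Real.pi / 2)) :
    F2 α β d θ 0 = -potDeriv d β θ - α * √β * (sepDeriv d β θ / sep d β θ ^ 2) := by
  have hs := sep_pos hβ hd h.1 h.2.le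
  rw [F2_eq hβ hd ⟨(thetaB_pos hβ).trans h.1, h.2⟩, distSq_eq hβ]
  rw [show sep d β θ ^ 2 + 0 ^ 2 = sep d β θ ^ 2 by ring, Real.sqrt_sq hs.le]
  field_simp

theorem F2_axis_left (hβ : 0 < β) (hd : 0 < d) (h : θ ∈ Ioo 0 (thetaB β)) :
    F2 α β d θ 0 = -potDeriv d β θ + α * √β * (sepDeriv d β θ / sep d β θ ^ 2) := by
  have hs := sep_neg hβ hd h.1.le h.2
  rw [F2_eq hβ hd ⟨h.1, h.2.trans (thetaB_lt β)⟩, distSq_eq hβ]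
  rw [show sep d β θ ^ 2 + 0 ^ 2 = sep d β θ ^ 2 by ring, Real.sqrt_sq_eq_abs, abs_of_neg hs]
  field_simp
  ring

theorem F2_axis_strictMonoOn_right (hα : 0 < α) (hβ : 0 < β) (hd : 0 < d) :
    StrictMonoOn (fun θ => F2 α β d θ 0) (Ioo (thetaB β) (Real.pi / 2)) := by
  intro x hx y hy hxy
  have hB := thetaB_pos hβ
  have hx' : x ∈ Ioo 0 (Real.pi / 2) := ⟨hB.trans hx.1, hx.2⟩
  have hy' : y ∈ Ioo 0 (Real.pi / 2) := ⟨hB.trans hy.1, hy.2⟩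
  have h1 := sep_pos hβ hd hx.1 hx.2.le
  have h2 := sep_strictMonoOn hβ hd (Ioo_subset_Icc_self hx') (Ioo_subset_Icc_self hy') hxy
  have h3 := sepDeriv_div_lt hβ hd hx' hy' (pow_pos h1 2) (by gcongr)
  have h4 := potDeriv_strictAntiOn hβ hd hx' hy' hxy
  have hb := Real.sqrt_pos.2 hβ
  have h5 := mul_lt_mul_of_pos_left h3 (show 0 < α * √β by positivity)
  simp only [F2_axis_right hβ hd hx, F2_axis_right hβ hd hy]
  linarith

theorem F2_axis_strictMonoOn_left (hα : 0 < α) (hβ : 0 < β) (hd : 0 < d) :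
    StrictMonoOn (fun θ => F2 α β d θ 0) (Ioo 0 (thetaB β)) := by
  intro x hx y hy hxy
  have hB := thetaB_lt β
  have hx' : x ∈ Ioo 0 (Real.pi / 2) := ⟨hx.1, hx.2.trans hB⟩
  have hy' : y ∈ Ioo 0 (Real.pi / 2) := ⟨hy.1, hy.2.trans hB⟩
  have h1 := sep_neg hβ hd hy.1.le hy.2
  have h2 := sep_strictMonoOn hβ hd (Ioo_subset_Icc_self hx') (Ioo_subset_Icc_self hy') hxy
  have h3 := sepDeriv_div_lt hβ hd hy' hx'
    (pow_pos (neg_pos.2 h1) 2 |>.trans_eq (neg_sq _)) (by nlinarith)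
  have h4 := potDeriv_strictAntiOn hβ hd hx' hy' hxy
  have hb := Real.sqrt_pos.2 hβ
  have h5 := mul_lt_mul_of_pos_left h3 (show 0 < α * √β by positivity)
  simp only [F2_axis_left hβ hd hx, F2_axis_left hβ hd hy]
  linarith

theorem exists_F2_axis_eq_zero_right (hα : 0 < α) (hβ : 0 < β) (hd : 0 < d) :
    ∃ θ ∈ Ioo (thetaB β) (Real.pi / 2), F2 α β d θ 0 = 0 := by
  have hB := thetaB_pos hβ
  have hB' := thetaB_lt β
  have hp : 0 < β ^ (3 / 2 : ℝ) := Real.rpow_pos_of_pos hβ _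
  have hb := Real.sqrt_pos.2 hβ
  -- `F2 θ 0` multiplied by its positive denominator extends continuously to the closed interval.
  let N : ℝ → ℝ := fun θ => (β ^ (3 / 2 : ℝ) * Real.sin θ - Real.cos θ) * sep d β θ ^ 2
    - α * √β * sepDeriv d β θ * (d * Real.sin θ * Real.cos θ)
  have hN : Continuous N := by
    have := continuous_sep d β
    simp only [N, sepDeriv]
    fun_prop
  have hl : N (thetaB β) < 0 := by
    have h1 := sin_pos_of_mem ⟨hB, hB'⟩
    have h2 := cos_pos_of_mem ⟨hB, hB'⟩
    have h3 := sepDeriv_pos hβ hd ⟨hB, hB'⟩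
    have : 0 < α * √β * sepDeriv d β (thetaB β)
      * (d * Real.sin (thetaB β) * Real.cos (thetaB β)) := by positivity
    simp only [N, sep_thetaB hβ]
    linarith
  have hr : 0 < N (Real.pi / 2) := by
    have := sep_pos hβ hd hB' le_rfl
    simp only [N, Real.sin_pi_div_two, Real.cos_pi_div_two]
    simp only [mul_one, sub_zero, mul_zero]
    have := Real.sqrt_pos.2 hβ
    positivity
  obtain ⟨θ, hθ, h⟩ := intermediate_value_Ioo hB'.le hN.continuousOn ⟨hl, hr⟩
  refine ⟨θ, hθ, ?_⟩
  have h1 := sin_pos_of_mem ⟨hB.trans hθ.1, hθ.2⟩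
  have h2 := cos_pos_of_mem ⟨hB.trans hθ.1, hθ.2⟩
  have h3 := sep_pos hβ hd hθ.1 hθ.2.le
  have h4 : F2 α β d θ 0 = N θ / (d * Real.sin θ * Real.cos θ * sep d β θ ^ 2) := by
    rw [F2_axis_right hβ hd hθ, potDeriv]
    simp only [N]
    field_simp
    ring
  rw [h4, h, zero_div]

theorem exists_F2_axis_eq_zero_left (hα : 0 < α) (hβ : 0 < β) (hd : 0 < d) :
    ∃ θ ∈ Ioo 0 (thetaB β), F2 α β d θ 0 = 0 := by
  have hB := thetaB_pos hβ
  have hB' := thetaB_lt β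
  have hb := Real.sqrt_pos.2 hβ
  let N : ℝ → ℝ := fun θ => (β ^ (3 / 2 : ℝ) * Real.sin θ - Real.cos θ) * sep d β θ ^ 2
    + α * √β * sepDeriv d β θ * (d * Real.sin θ * Real.cos θ)
  have hN : Continuous N := by
    have := continuous_sep d β
    simp only [N, sepDeriv]
    fun_prop
  have hl : N 0 < 0 := by
    have := pow_pos (neg_pos.2 (sep_neg hβ hd le_rfl hB)) 2
    simp only [N, Real.sin_zero, Real.cos_zero]
    linarith [neg_sq (sep d β 0)]
  have hr : 0 < N (thetaB β) := by
    have h1 := sin_pos_of_mem ⟨hB, hB'⟩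
    have h2 := cos_pos_of_mem ⟨hB, hB'⟩
    have h3 := sepDeriv_pos hβ hd ⟨hB, hB'⟩
    have : 0 < α * √β * sepDeriv d β (thetaB β)
      * (d * Real.sin (thetaB β) * Real.cos (thetaB β)) := by positivity
    simp only [N, sep_thetaB hβ]
    linarith
  obtain ⟨θ, hθ, h⟩ := intermediate_value_Ioo hB.le hN.continuousOn ⟨hl, hr⟩
  refine ⟨θ, hθ, ?_⟩
  have h1 := sin_pos_of_mem ⟨hθ.1, hθ.2.trans hB'⟩
  have h2 := cos_pos_of_mem ⟨hθ.1, hθ.2.trans hB'⟩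
  have h3 := (sep_neg hβ hd hθ.1.le hθ.2).ne
  have h4 : F2 α β d θ 0 = N θ / (d * Real.sin θ * Real.cos θ * sep d β θ ^ 2) := by
    rw [F2_axis_left hβ hd hθ, potDeriv]
    simp only [N]
    field_simp
    ring
  rw [h4, h, zero_div]

theorem exists_isCriticalPair (hα : 0 < α) (hβ : 0 < β) (hd : 0 < d) :
    ∃ θs θss, IsCriticalPair α β d θs θss := by
  obtain ⟨θs, hs, hs0⟩ := exists_F2_axis_eq_zero_left hα hβ hd
  obtain ⟨θss, hss, hss0⟩ := exists_F2_axis_eq_zero_right hα hβ hd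
  have hl := F2_axis_strictMonoOn_left hα hβ hd
  have hr := F2_axis_strictMonoOn_right hα hβ hd
  exact ⟨θs, θss, hs.1, hs.2, hss.1, hss.2, hs0, hss0,
    fun θ h => (hl ⟨h.1, h.2.trans hs.2⟩ hs h.2).trans_eq hs0,
    fun θ h => hs0.symm.trans_lt (hl hs ⟨hs.1.trans h.1, h.2⟩ h.1),
    fun θ h => (hr ⟨h.1, h.2.trans hss.2⟩ hss h.2).trans_eq hss0,
    fun θ h => hss0.symm.trans_lt (hr hss ⟨hss.1.trans h.1, h.2⟩ h.1)⟩

theorem mem_Omega_of_ne (hθ : θ ∈ Ioo 0 (Real.pi / 2)) (h : θ ≠ thetaB β) (W : ℝ) :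
    (θ, W) ∈ Omega β :=
  ⟨hθ.1, hθ.2, fun e => h (congrArg Prod.fst e)⟩

theorem hasDerivAt_Ham_axis (α : ℝ) (hβ : 0 < β) (hd : 0 < d) (hθ : θ ∈ Ioo 0 (Real.pi / 2))
    (h : θ ≠ thetaB β) : HasDerivAt (fun x => Ham α β d x 0) (-F2 α β d θ 0) θ := by
  simpa using hasDerivAt_Ham_comp (α := α) hβ hd (x := id) (y := fun _ => 0) (t := θ)
    (mem_Omega_of_ne hθ h 0) (hasDerivAt_id θ) (hasDerivAt_const θ 0)

/-- For fixed `θ` the Hamiltonian is smallest on the axis `W = 0`. -/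
theorem Ham_axis_le (hα : 0 < α) (hβ : 0 < β) (hd : 0 < d) (hθ : θ ∈ Ioo 0 (Real.pi / 2))
    (h : θ ≠ thetaB β) (W : ℝ) : Ham α β d θ 0 ≤ Ham α β d θ W := by
  have h0 := distSq_pos hβ hd (mem_Omega_of_ne hθ h 0)
  have hb := Real.sqrt_pos.2 hβ
  have h1 := Real.sqrt_pos.2 h0
  rw [Ham_eq hθ, Ham_eq hθ]
  have h2 : distSq d β θ 0 ≤ distSq d β θ W := by
    rw [distSq_eq hβ, distSq_eq hβ]; nlinarith
  gcongr

theorem F1_eq_zero_iff (hα : 0 < α) (hβ : 0 < β) (hd : 0 < d) (h : (θ, W) ∈ Omega β) :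
    F1 α β d θ W = 0 ↔ W = 0 := by
  have h1 := Real.sqrt_pos.2 (distSq_pos hβ hd h)
  have hb := Real.sqrt_pos.2 hβ
  rw [F1_eq hβ, div_eq_zero_iff, or_iff_left (by positivity), mul_eq_zero,
    or_iff_right (by positivity)]

end Axis

namespace IsCriticalPair

variable {α β d θs θss θ W : ℝ} (P : IsCriticalPair α β d θs θss)
include P

theorem left_mem : θs ∈ Ioo 0 (Real.pi / 2) :=
  ⟨P.pos, P.lt_thetaB.trans (P.thetaB_lt.trans P.lt_pi_div_two)⟩

theorem right_mem : θss ∈ Ioo 0 (Real.pi / 2) :=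
  ⟨P.pos.trans (P.lt_thetaB.trans P.thetaB_lt), P.lt_pi_div_two⟩

theorem equilibria_eq (hα : 0 < α) (hβ : 0 < β) (hd : 0 < d) :
    equilibria α β d = {(θs, 0), (θss, 0)} := by
  ext ⟨θ, W⟩
  simp only [equilibria, mem_ofPred_eq, mem_insert_iff, mem_singleton_iff, Prod.mk.injEq]
  constructor
  · rintro ⟨hΩ, h1, h2⟩
    obtain rfl := (F1_eq_zero_iff hα hβ hd hΩ).1 h1
    have hθ := mem_Ioo_of_mem_Omega hΩ
    have hne : θ ≠ thetaB β := fun e => hΩ.2.2 (by rw [e])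
    rcases hne.lt_or_gt with h | h
    · rcases lt_trichotomy θ θs with h' | h' | h'
      · exact absurd h2 (P.F2_neg_of_lt θ ⟨hθ.1, h'⟩).ne
      · exact Or.inl ⟨h', rfl⟩
      · exact absurd h2 (P.F2_pos_of_gt θ ⟨h', h⟩).ne'
    · rcases lt_trichotomy θ θss with h' | h' | h'
      · exact absurd h2 (P.F2_neg_of_lt' θ ⟨h, h'⟩).ne
      · exact Or.inr ⟨h', rfl⟩
      · exact absurd h2 (P.F2_pos_of_gt' θ ⟨h', hθ.2⟩).ne'
  · rintro (⟨rfl, rfl⟩ | ⟨rfl, rfl⟩)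
    · exact ⟨mem_Omega_of_ne P.left_mem P.lt_thetaB.ne 0, by simp [F1], P.left_eq⟩
    · exact ⟨mem_Omega_of_ne P.right_mem P.thetaB_lt.ne' 0, by simp [F1], P.right_eq⟩

theorem Ham_strictMonoOn_right (hβ : 0 < β) (hd : 0 < d) :
    StrictMonoOn (fun θ => Ham α β d θ 0) (Ioc (thetaB β) θss) := by
  have hder : ∀ θ ∈ Ioc (thetaB β) θss, HasDerivAt (fun x => Ham α β d x 0) (-F2 α β d θ 0) θ :=
    fun θ h => hasDerivAt_Ham_axis α hβ hd
      ⟨(thetaB_pos hβ).trans h.1, h.2.trans_lt P.lt_pi_div_two⟩ h.1.ne'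
  refine strictMonoOn_of_deriv_pos (convex_Ioc _ _)
    (fun θ h => (hder θ h).continuousAt.continuousWithinAt) fun θ h => ?_
  rw [interior_Ioc] at h
  rw [(hder θ (Ioo_subset_Ioc_self h)).deriv]
  exact neg_pos.2 (P.F2_neg_of_lt' θ h)

theorem Ham_strictAntiOn_right (hβ : 0 < β) (hd : 0 < d) :
    StrictAntiOn (fun θ => Ham α β d θ 0) (Ico θss (Real.pi / 2)) := by
  have hder : ∀ θ ∈ Ico θss (Real.pi / 2),
      HasDerivAt (fun x => Ham α β d x 0) (-F2 α β d θ 0) θ :=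
    fun θ h => hasDerivAt_Ham_axis α hβ hd
      ⟨P.right_mem.1.trans_le h.1, h.2⟩ (P.thetaB_lt.trans_le h.1).ne'
  refine strictAntiOn_of_deriv_neg (convex_Ico _ _)
    (fun θ h => (hder θ h).continuousAt.continuousWithinAt) fun θ h => ?_
  rw [interior_Ico] at h
  rw [(hder θ (Ioo_subset_Ico_self h)).deriv]
  exact neg_neg_iff_pos.2 (P.F2_pos_of_gt' θ h)

theorem Ham_strictMonoOn_left (hβ : 0 < β) (hd : 0 < d) :
    StrictMonoOn (fun θ => Ham α β d θ 0) (Ioc 0 θs) := by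
  have hder : ∀ θ ∈ Ioc 0 θs, HasDerivAt (fun x => Ham α β d x 0) (-F2 α β d θ 0) θ :=
    fun θ h => hasDerivAt_Ham_axis α hβ hd
      ⟨h.1, h.2.trans_lt P.left_mem.2⟩ (h.2.trans_lt P.lt_thetaB).ne
  refine strictMonoOn_of_deriv_pos (convex_Ioc _ _)
    (fun θ h => (hder θ h).continuousAt.continuousWithinAt) fun θ h => ?_
  rw [interior_Ioc] at h
  rw [(hder θ (Ioo_subset_Ioc_self h)).deriv]
  exact neg_pos.2 (P.F2_neg_of_lt θ h)

theorem Ham_strictAntiOn_left (hβ : 0 < β) (hd : 0 < d) :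
    StrictAntiOn (fun θ => Ham α β d θ 0) (Ico θs (thetaB β)) := by
  have hder : ∀ θ ∈ Ico θs (thetaB β),
      HasDerivAt (fun x => Ham α β d x 0) (-F2 α β d θ 0) θ :=
    fun θ h => hasDerivAt_Ham_axis α hβ hd
      ⟨P.pos.trans_le h.1, h.2.trans (FilamentPair.thetaB_lt β)⟩ h.2.ne
  refine strictAntiOn_of_deriv_neg (convex_Ico _ _)
    (fun θ h => (hder θ h).continuousAt.continuousWithinAt) fun θ h => ?_
  rw [interior_Ico] at h
  rw [(hder θ (Ioo_subset_Ico_self h)).deriv]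
  exact neg_neg_iff_pos.2 (P.F2_pos_of_gt θ h)

theorem Ham_lt_right (hβ : 0 < β) (hd : 0 < d) (h : θ ∈ Ioo (thetaB β) (Real.pi / 2))
    (hne : θ ≠ θss) : Ham α β d θ 0 < Ham α β d θss 0 := by
  rcases hne.lt_or_gt with h' | h'
  · exact P.Ham_strictMonoOn_right hβ hd ⟨h.1, h'.le⟩ ⟨P.thetaB_lt, le_rfl⟩ h'
  · exact P.Ham_strictAntiOn_right hβ hd ⟨le_rfl, P.lt_pi_div_two⟩ ⟨h'.le, h.2⟩ h'

theorem Ham_lt_left (hβ : 0 < β) (hd : 0 < d) (h : θ ∈ Ioo 0 (thetaB β))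
    (hne : θ ≠ θs) : Ham α β d θ 0 < Ham α β d θs 0 := by
  rcases hne.lt_or_gt with h' | h'
  · exact P.Ham_strictMonoOn_left hβ hd ⟨h.1, h'.le⟩ ⟨P.pos, le_rfl⟩ h'
  · exact P.Ham_strictAntiOn_left hβ hd ⟨le_rfl, P.lt_thetaB⟩ ⟨h'.le, h.2⟩ h'

end IsCriticalPair

/-! ### Conservation of energy and global well-posedness -/

section WellPosed

variable {α β d θ W E : ℝ}

/-- The potential is negative and tends to `-∞` at both ends of `(0, π/2)`. -/
theorem bounds_of_le_pot (hβ : 0 < β) (hd : 0 < d) (hθ : θ ∈ Ioo 0 (Real.pi / 2))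
    (h : E ≤ pot d β θ) :
    E < 0 ∧ Real.cos θ ≤ 1 - Real.exp (2 * d * E) ∧
      Real.sin θ ≤ 1 - Real.exp (2 * d * E / β ^ (3 / 2 : ℝ)) := by
  have hs := sin_pos_of_mem hθ
  have hc := cos_pos_of_mem hθ
  have h1 := sub_pos.2 (sin_lt_one_of_mem hθ)
  have h2 := sub_pos.2 (cos_lt_one_of_mem hθ)
  have hp : 0 < β ^ (3 / 2 : ℝ) := Real.rpow_pos_of_pos hβ _
  have l1 := Real.log_neg h1 (by linarith)
  have l2 := Real.log_neg h2 (by linarith)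
  have l3 := Real.log_pos (show 1 < 1 + Real.sin θ by linarith)
  have l4 := Real.log_pos (show 1 < 1 + Real.cos θ by linarith)
  have hp' : 0 < -(β ^ (3 / 2 : ℝ) * Real.log (1 - Real.sin θ)) := by nlinarith
  have hp'' := mul_pos hp l3
  have h' : 2 * d * E ≤ β ^ (3 / 2 : ℝ) * (Real.log (1 - Real.sin θ) - Real.log (1 + Real.sin θ))
      + (Real.log (1 - Real.cos θ) - Real.log (1 + Real.cos θ)) := by
    rw [pot, one_div_mul_eq_div, le_div_iff₀ (by positivity)] at h
    linarith
  rw [mul_sub] at h'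
  have e1 : 2 * d * E ≤ Real.log (1 - Real.cos θ) := by linarith
  have e2 : 2 * d * E / β ^ (3 / 2 : ℝ) ≤ Real.log (1 - Real.sin θ) := by
    rw [div_le_iff₀' hp]; linarith
  rw [Real.le_log_iff_exp_le h2] at e1
  rw [Real.le_log_iff_exp_le h1] at e2
  refine ⟨?_, by linarith, by linarith⟩
  by_contra hE
  have : 0 ≤ 2 * d * E := by have := not_lt.1 hE; positivity
  linarith

/-- On an energy level `θ` keeps away from `0` and `π/2` and the filaments keep away from each
other. -/
theorem bounds_of_Ham_eq (hα : 0 < α) (hβ : 0 < β) (hd : 0 < d) (h : (θ, W) ∈ Omega β)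
    (hE : Ham α β d θ W = E) :
    Real.cos θ ≤ 1 - Real.exp (2 * d * E) ∧
      Real.sin θ ≤ 1 - Real.exp (2 * d * E / β ^ (3 / 2 : ℝ)) ∧
      α * √β ≤ √(distSq d β θ W) * -E := by
  have hθ := mem_Ioo_of_mem_Omega h
  have hr := Real.sqrt_pos.2 (distSq_pos hβ hd h)
  have hb := Real.sqrt_pos.2 hβ
  rw [Ham_eq hθ] at hE
  have h0 : 0 < α * √β / √(distSq d β θ W) := by positivity
  obtain ⟨-, h1, h2⟩ := bounds_of_le_pot hβ hd hθ (show E ≤ pot d β θ by linarith)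
  obtain ⟨hneg, -, -⟩ := bounds_of_le_pot hβ hd hθ (le_refl (pot d β θ))
  refine ⟨h1, h2, ?_⟩
  rw [← div_le_iff₀' hr]
  linarith

/-- The speed of `W` is bounded on an energy level. -/
theorem exists_abs_F2_le (hα : 0 < α) (hβ : 0 < β) (hd : 0 < d) (E : ℝ) :
    ∃ B, 0 ≤ B ∧ ∀ θ W, (θ, W) ∈ Omega β → Ham α β d θ W = E → |F2 α β d θ W| ≤ B := by
  have hb := Real.sqrt_pos.2 hβ
  have hp : 0 < β ^ (3 / 2 : ℝ) := Real.rpow_pos_of_pos hβ _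
  set e₁ := Real.exp (2 * d * E) with he₁
  set e₂ := Real.exp (2 * d * E / β ^ (3 / 2 : ℝ)) with he₂
  have p₁ : 0 < e₁ := Real.exp_pos _
  have p₂ : 0 < e₂ := Real.exp_pos _
  refine ⟨1 / d * (1 / e₁ + β ^ (3 / 2 : ℝ) / e₂)
    + d / √β * (√β + 1) * E ^ 2 / (α * √β), by positivity, fun θ W h hE => ?_⟩
  obtain ⟨h1, h2, h3⟩ := bounds_of_Ham_eq hα hβ hd h hE
  have hθ := mem_Ioo_of_mem_Omega h
  have hs := sin_pos_of_mem hθ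
  have hc := cos_pos_of_mem hθ
  have hr := Real.sqrt_pos.2 (distSq_pos hβ hd h)
  -- `sin θ ≥ sin² θ = (1 - cos θ) (1 + cos θ) ≥ 1 - cos θ`, and likewise for the cosine.
  have hs' : e₁ ≤ Real.sin θ := by
    nlinarith [Real.sin_sq_add_cos_sq θ, sin_lt_one_of_mem hθ]
  have hc' : e₂ ≤ Real.cos θ := by
    nlinarith [Real.sin_sq_add_cos_sq θ, cos_lt_one_of_mem hθ]
  have hsep : |sep d β θ| ≤ √(distSq d β θ W) := by
    refine Real.abs_le_sqrt ?_
    rw [distSq_eq hβ]; nlinarith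
  have hsep' : |sepDeriv d β θ| ≤ d / √β * (√β + 1) := by
    rw [abs_of_pos (sepDeriv_pos hβ hd hθ), sepDeriv]
    have := (sin_lt_one_of_mem hθ).le
    have := (cos_lt_one_of_mem hθ).le
    gcongr
    nlinarith
  have b1 : |potDeriv d β θ| ≤ 1 / d * (1 / e₁ + β ^ (3 / 2 : ℝ) / e₂) := by
    rw [potDeriv, abs_mul, abs_of_pos (show 0 < 1 / d by positivity)]
    refine mul_le_mul_of_nonneg_left ((abs_sub _ _).trans ?_) (by positivity)
    rw [abs_of_pos (show 0 < 1 / Real.sin θ by positivity),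
      abs_of_pos (show 0 < β ^ (3 / 2 : ℝ) / Real.cos θ by positivity)]
    gcongr
  have b2 : |α * √β * (sep d β θ * sepDeriv d β θ) / √(distSq d β θ W) ^ 3|
      ≤ d / √β * (√β + 1) * E ^ 2 / (α * √β) := by
    set r := √(distSq d β θ W) with hr_def
    set R := d / √β * (√β + 1) with hR
    have hA : 0 < α * √β := by positivity
    rw [abs_div, abs_mul (α * √β), abs_mul (sep d β θ), abs_of_pos hA,
      abs_of_pos (show 0 < r ^ 3 by positivity), div_le_div_iff₀ (by positivity) hA]
    calc α * √β * (|sep d β θ| * |sepDeriv d β θ|) * (α * √β)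
        ≤ α * √β * (r * R) * (α * √β) := by gcongr
      _ = (α * √β) ^ 2 * (r * R) := by ring
      _ ≤ (r * -E) ^ 2 * (r * R) := by gcongr
      _ = R * E ^ 2 * r ^ 3 := by ring
  rw [F2_eq hβ hd hθ]
  refine (abs_sub _ _).trans ?_
  rw [abs_neg]
  exact add_le_add b1 b2

/-- The part of an energy level on which `|W| ≤ M` lies in a compact subset of the phase space. -/
theorem exists_isCompact_level (hα : 0 < α) (hβ : 0 < β) (hd : 0 < d) (E M : ℝ) :
    ∃ K : Set (ℝ × ℝ), IsCompact K ∧ K ⊆ Omega β ∧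
      ∀ θ W, (θ, W) ∈ Omega β → Ham α β d θ W = E → |W| ≤ M → (θ, W) ∈ K := by
  refine ⟨(Icc 0 (Real.pi / 2) ×ˢ Icc (-M) M) ∩
    ({p | Real.cos p.1 ≤ 1 - Real.exp (2 * d * E)} ∩
      ({p | Real.sin p.1 ≤ 1 - Real.exp (2 * d * E / β ^ (3 / 2 : ℝ))} ∩
        {p | α * √β ≤ √(distSq d β p.1 p.2) * -E})), ?_, ?_, fun θ W h hE hM => ?_⟩
  · refine (isCompact_Icc.prod isCompact_Icc).inter_right ?_
    refine (isClosed_le (Real.continuous_cos.comp continuous_fst) continuous_const).inter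
      ((isClosed_le (Real.continuous_sin.comp continuous_fst) continuous_const).inter
        (isClosed_le continuous_const ?_))
    unfold distSq
    fun_prop
  · rintro ⟨θ, W⟩ ⟨⟨hθ, -⟩, h1, h2, h3⟩
    simp only [mem_ofPred_eq] at hθ h1 h2 h3
    have e1 := Real.exp_pos (2 * d * E)
    have e2 := Real.exp_pos (2 * d * E / β ^ (3 / 2 : ℝ))
    refine ⟨hθ.1.lt_of_ne' ?_, hθ.2.lt_of_ne ?_, ?_⟩
    · rintro rfl
      rw [Real.cos_zero] at h1
      linarith
    · rintro rfl
      rw [Real.sin_pi_div_two] at h2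
      linarith
    · intro e
      obtain ⟨rfl, rfl⟩ := Prod.mk.inj e
      rw [distSq_eq hβ, sep_thetaB hβ] at h3
      have hb := Real.sqrt_pos.2 hβ
      have : 0 < α * √β := by positivity
      norm_num at h3
      linarith
  · have hθ := mem_Ioo_of_mem_Omega h
    exact ⟨⟨Ioo_subset_Icc_self hθ, abs_le.1 hM⟩, bounds_of_Ham_eq hα hβ hd h hE⟩

theorem isSolution_iff {p₀ : ℝ × ℝ} {γ : ℝ → ℝ × ℝ} :
    IsSolution α β d p₀ γ ↔ γ 0 = p₀ ∧
      ∀ t, HasDerivAt γ (F1 α β d (γ t).1 (γ t).2, F2 α β d (γ t).1 (γ t).2) t ∧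
        γ t ∈ Omega β := by
  constructor
  · intro h
    exact ⟨h.init, fun t => ⟨(h.hasDerivAt_fst t).prodMk (h.hasDerivAt_snd t), h.mem_Omega t⟩⟩
  · rintro ⟨h0, h⟩
    exact ⟨h0, fun t => (h t).2, fun t => (h t).1.fst, fun t => (h t).1.snd⟩

theorem exists_isSolution (hα : 0 < α) (hβ : 0 < β) (hd : 0 < d) {p₀ : ℝ × ℝ}
    (hp₀ : p₀ ∈ Omega β) : ∃ γ, IsSolution α β d p₀ γ := by
  simp_rw [isSolution_iff]
  refine exists_global_of_apriori (isOpen_Omega β) (contDiffOn_field α hβ hd) hp₀ fun T hT => ?_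
  set E := Ham α β d p₀.1 p₀.2 with hE
  obtain ⟨B, hB, hF2⟩ := exists_abs_F2_le hα hβ hd E
  obtain ⟨K, hK, hKU, hlevel⟩ := exists_isCompact_level hα hβ hd E (|p₀.2| + B * T)
  refine ⟨K, hK, hKU, fun χ γ hχ h0 hγ hmem => ?_⟩
  have h0T : (0 : ℝ) ∈ Ioo (-T) T := ⟨by linarith, hT⟩
  have hcons : ∀ t ∈ Ioo (-T) T, Ham α β d (γ t).1 (γ t).2 = E := by
    have hder : ∀ t ∈ Ioo (-T) T,
        HasDerivAt (fun s => Ham α β d (γ s).1 (γ s).2) 0 t := by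
      intro t ht
      have := hasDerivAt_Ham_comp (α := α) hβ hd (hmem t ht) (hγ t ht).fst (hγ t ht).snd
      refine this.congr_deriv ?_
      simp only [Prod.smul_mk, smul_eq_mul]
      ring
    intro t ht
    rw [hE, ← h0]
    exact isOpen_Ioo.is_const_of_deriv_eq_zero isPreconnected_Ioo
      (fun s hs => (hder s hs).differentiableAt.differentiableWithinAt)
      (fun s hs => (hder s hs).deriv) ht h0T
  intro t ht
  refine hlevel _ _ (hmem t ht) (hcons t ht) ?_
  have hW : |(γ t).2 - (γ 0).2| ≤ B * |t - 0| := by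
    refine (convex_Ioo (-T) T).norm_image_sub_le_of_norm_hasDerivWithin_le (f := fun s => (γ s).2)
      (fun s hs => HasDerivAt.hasDerivWithinAt (hγ s hs).snd) (fun s hs => ?_) h0T ht
    have h1 := hF2 _ _ (hmem s hs) (hcons s hs)
    rw [Prod.smul_snd, smul_eq_mul, Real.norm_eq_abs, abs_mul, abs_of_nonneg (hχ _).1]
    exact (mul_le_of_le_one_left (abs_nonneg _) (hχ _).2).trans h1
  have ht' : |t - 0| ≤ T := by rw [sub_zero]; exact abs_le.2 ⟨ht.1.le, ht.2.le⟩
  have h2 : |(γ t).2| ≤ |(γ 0).2| + |(γ t).2 - (γ 0).2| := by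
    have := abs_add_le (γ 0).2 ((γ t).2 - (γ 0).2)
    rwa [add_sub_cancel] at this
  have h3 := mul_le_mul_of_nonneg_left ht' hB
  rw [h0] at h2 hW
  linarith

/-- Two solutions that meet at one time agree. -/
theorem IsSolution.eq_of_eq (hβ : 0 < β) (hd : 0 < d) {p q : ℝ × ℝ} {γ₁ γ₂ : ℝ → ℝ × ℝ}
    (h₁ : IsSolution α β d p γ₁) (h₂ : IsSolution α β d q γ₂) {t₀ : ℝ}
    (h : γ₁ t₀ = γ₂ t₀) : γ₁ = γ₂ := by
  funext t
  have hmem : ∀ s, |s| ≤ max |t| |t₀| → s ∈ Ioo (-(max |t| |t₀| + 1)) (max |t| |t₀| + 1) :=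
    fun s hs => ⟨by linarith [neg_abs_le s], by linarith [le_abs_self s]⟩
  exact eqOn_of_hasDerivAt (isOpen_Omega β) (contDiffOn_field α hβ hd)
    (hmem t₀ (le_max_right _ _)) (fun s _ => (isSolution_iff.1 h₁).2 s)
    (fun s _ => (isSolution_iff.1 h₂).2 s) h (hmem t (le_max_left _ _))

theorem existsUnique_isSolution (hα : 0 < α) (hβ : 0 < β) (hd : 0 < d) {p₀ : ℝ × ℝ}
    (hp₀ : p₀ ∈ Omega β) : ∃! γ, IsSolution α β d p₀ γ := by
  obtain ⟨γ, hγ⟩ := exists_isSolution hα hβ hd hp₀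
  exact ⟨γ, hγ, fun γ' h' => h'.eq_of_eq hβ hd hγ (h'.init.trans hγ.init.symm)⟩

namespace IsSolution

variable {p₀ : ℝ × ℝ} {γ : ℝ → ℝ × ℝ} (S : IsSolution α β d p₀ γ)
include S

theorem continuous : Continuous γ :=
  continuous_iff_continuousAt.2 fun t => ((isSolution_iff.1 S).2 t).1.continuousAt

theorem Ham_eq (hβ : 0 < β) (hd : 0 < d) (t : ℝ) :
    Ham α β d (γ t).1 (γ t).2 = Ham α β d p₀.1 p₀.2 := by
  have hder : ∀ t, HasDerivAt (fun s => Ham α β d (γ s).1 (γ s).2) 0 t := fun t =>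
    (hasDerivAt_Ham_comp (α := α) hβ hd (S.mem_Omega t) (S.hasDerivAt_fst t)
      (S.hasDerivAt_snd t)).congr_deriv (by ring)
  rw [← S.init]
  exact is_const_of_deriv_eq_zero (fun t => (hder t).differentiableAt) (fun t => (hder t).deriv) t 0

/-- The system is reversible: reflecting a solution in time and in `W` yields a solution. -/
theorem reflect (c : ℝ) :
    IsSolution α β d ((γ c).1, -(γ c).2) fun t => ((γ (c - t)).1, -(γ (c - t)).2) where
  init := by rw [sub_zero]
  mem_Omega t := Omega_neg (S.mem_Omega _)
  hasDerivAt_fst t := by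
    simpa [F1_neg] using (S.hasDerivAt_fst (c - t)).comp_const_sub c t
  hasDerivAt_snd t := by
    simpa [F2_neg] using ((S.hasDerivAt_snd (c - t)).comp_const_sub c t).fun_neg

/-- A solution that meets the axis `W = 0` at time `c` is symmetric about that time. -/
theorem symm_of_snd_eq_zero (hβ : 0 < β) (hd : 0 < d) {c : ℝ} (hc : (γ c).2 = 0) (t : ℝ) :
    γ (2 * c - t) = ((γ t).1, -(γ t).2) := by
  have := (S.reflect (2 * c)).eq_of_eq hβ hd S (t₀ := c)
    (by rw [two_mul, add_sub_cancel_right]; exact Prod.ext rfl (by rw [hc, neg_zero]))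
  have := congrFun this (2 * c - t)
  rw [← this]
  simp

/-- A solution that meets the axis `W = 0` at two times is periodic. -/
theorem periodic_of_snd_eq_zero (hβ : 0 < β) (hd : 0 < d) {c₁ c₂ : ℝ} (h₁ : (γ c₁).2 = 0)
    (h₂ : (γ c₂).2 = 0) : Function.Periodic γ (2 * (c₂ - c₁)) := by
  intro t
  have e1 := S.symm_of_snd_eq_zero hβ hd h₁ t
  have e2 := S.symm_of_snd_eq_zero hβ hd h₂ (2 * c₁ - t)
  rw [show t + 2 * (c₂ - c₁) = 2 * c₂ - (2 * c₁ - t) by ring, e2, e1]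
  simp

/-- A solution through an equilibrium is constant. -/
theorem const_of_mem_equilibria (hβ : 0 < β) (hd : 0 < d) {c : ℝ}
    (hc : γ c ∈ equilibria α β d) (t : ℝ) : γ t = γ c := by
  have hconst : IsSolution α β d (γ c) fun _ => γ c :=
    ⟨rfl, fun _ => hc.1, fun t => by simpa [hc.2.1] using hasDerivAt_const t (γ c).1,
      fun t => by simpa [hc.2.2] using hasDerivAt_const t (γ c).2⟩
  exact congrFun (S.eq_of_eq hβ hd hconst (t₀ := c) rfl) t

/-- A limit point that a solution converges to is an equilibrium. -/
theorem mem_equilibria_of_tendsto (hβ : 0 < β) (hd : 0 < d) {p : ℝ × ℝ} (hp : p ∈ Omega β)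
    (h : Tendsto γ atTop (𝓝 p)) : p ∈ equilibria α β d := by
  have hF := ((contDiffOn_field α hβ hd).continuousOn.continuousAt
    ((isOpen_Omega β).mem_nhds hp)).tendsto.comp h
  have h1 := (continuous_fst.tendsto _).comp hF
  have h2 := (continuous_snd.tendsto _).comp hF
  exact ⟨hp, eq_zero_of_tendsto_of_tendsto_deriv S.hasDerivAt_fst
      ((continuous_fst.tendsto _).comp h) h1,
    eq_zero_of_tendsto_of_tendsto_deriv S.hasDerivAt_snd ((continuous_snd.tendsto _).comp h) h2⟩

end IsSolution

end WellPosed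

/-! ### Closed orbits around the collision point -/

section Level

variable {α β d θ W E : ℝ}

theorem pot_concaveOn (hβ : 0 < β) (hd : 0 < d) :
    ConcaveOn ℝ (Ioo 0 (Real.pi / 2)) (pot d β) := by
  have hder := fun θ (h : θ ∈ Ioo 0 (Real.pi / 2)) => hasDerivAt_pot (d := d) β hd h
  refine AntitoneOn.concaveOn_of_deriv (convex_Ioo _ _)
    (fun θ h => (hder θ h).continuousAt.continuousWithinAt) ?_ ?_
  · rw [interior_Ioo]
    exact fun θ h => (hder θ h).differentiableAt.differentiableWithinAt
  · rw [interior_Ioo]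
    intro x hx y hy hxy
    rw [(hder x hx).deriv, (hder y hy).deriv]
    exact (potDeriv_strictAntiOn hβ hd).antitoneOn hx hy hxy

/-- The sublevel set `Ham ≤ E`, written in a form that also makes sense at `(θ_β, 0)`. -/
theorem Ham_le_iff (hβ : 0 < β) (hd : 0 < d) (h : (θ, W) ∈ Omega β) :
    Ham α β d θ W ≤ E ↔ √(distSq d β θ W) * (pot d β θ - E) ≤ α * √β := by
  have hr := Real.sqrt_pos.2 (distSq_pos hβ hd h)
  rw [Ham_eq (mem_Ioo_of_mem_Omega h), ← le_div_iff₀' hr, sub_le_comm]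

theorem Ham_eq_iff (hβ : 0 < β) (hd : 0 < d) (h : (θ, W) ∈ Omega β) :
    Ham α β d θ W = E ↔ √(distSq d β θ W) * (pot d β θ - E) = α * √β := by
  have hr := Real.sqrt_pos.2 (distSq_pos hβ hd h)
  rw [Ham_eq (mem_Ioo_of_mem_Omega h), sub_eq_iff_eq_add, ← sub_eq_iff_eq_add', eq_div_iff hr.ne',
    mul_comm]

/-- On an energy level, `W ^ 2` is a function of `θ`. -/
theorem sq_eq_of_Ham_eq (hα : 0 < α) (hβ : 0 < β) (hd : 0 < d) (h : (θ, W) ∈ Omega β)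
    (hE : Ham α β d θ W = E) :
    W ^ 2 = (α * √β / (pot d β θ - E)) ^ 2 - sep d β θ ^ 2 := by
  have hQ := distSq_pos hβ hd h
  have hr := Real.sqrt_pos.2 hQ
  have hb := Real.sqrt_pos.2 hβ
  rw [Ham_eq_iff hβ hd h] at hE
  have h0 : pot d β θ - E ≠ 0 := by
    intro h0
    rw [h0, mul_zero] at hE
    have : 0 < α * √β := by positivity
    exact this.ne hE
  rw [← hE, mul_div_cancel_right₀ _ h0, Real.sq_sqrt hQ.le, distSq_eq hβ]
  ring

theorem exists_tendsto_of_deriv_nonneg {f f' : ℝ → ℝ} {a M : ℝ}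
    (hf : ∀ t, HasDerivAt f (f' t) t) (h0 : ∀ t, a < t → 0 ≤ f' t) (hM : ∀ t, f t ≤ M) :
    ∃ L, Tendsto f atTop (𝓝 L) := by
  have hmono : MonotoneOn f (Ici a) := by
    refine monotoneOn_of_deriv_nonneg (convex_Ici a)
      (fun t _ => (hf t).continuousAt.continuousWithinAt)
      (fun t _ => (hf t).differentiableAt.differentiableWithinAt) fun t ht => ?_
    rw [interior_Ici] at ht
    rw [(hf t).deriv]
    exact h0 t ht
  have hmono' : Monotone fun t => f (max t a) := fun s t hst =>
    hmono (mem_Ici.2 (le_max_right _ _)) (mem_Ici.2 (le_max_right _ _)) (max_le_max_right a hst)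
  refine ⟨_, (tendsto_atTop_ciSup hmono' ⟨M, ?_⟩).congr' ?_⟩
  · rintro _ ⟨t, rfl⟩
    exact hM _
  · filter_upwards [eventually_ge_atTop a] with t ht
    simp only [max_eq_left ht]

theorem lt_of_forall_ne {f : ℝ → ℝ} (hf : Continuous f) {c s : ℝ} (hne : ∀ t, f t ≠ c)
    (hs : c < f s) (t : ℝ) : c < f t := by
  by_contra h
  obtain ⟨u, hu⟩ := mem_range_of_exists_le_of_exists_ge hf ⟨t, not_lt.1 h⟩ ⟨s, hs.le⟩
  exact hne u hu

theorem gt_of_forall_ne {f : ℝ → ℝ} (hf : Continuous f) {c s : ℝ} (hne : ∀ t, f t ≠ c)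
    (hs : f s < c) (t : ℝ) : f t < c := by
  by_contra h
  obtain ⟨u, hu⟩ := mem_range_of_exists_le_of_exists_ge hf ⟨s, hs.le⟩ ⟨t, not_lt.1 h⟩
  exact hne u hu

end Level

namespace IsCriticalPair

variable {α β d θs θss θ W E : ℝ} (P : IsCriticalPair α β d θs θss)
include P

theorem mem_Ioo_of_mem_Icc (h : θ ∈ Icc θs θss) : θ ∈ Ioo 0 (Real.pi / 2) :=
  ⟨P.pos.trans_le h.1, h.2.trans_lt P.lt_pi_div_two⟩

/-- Below the energy of both equilibria, the potential exceeds the energy on `[θs, θss]`. -/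
theorem exists_lt_pot_sub (hα : 0 < α) (hβ : 0 < β) (hd : 0 < d) (hs : E < Ham α β d θs 0)
    (hss : E < Ham α β d θss 0) : ∃ μ, 0 < μ ∧ ∀ θ ∈ Icc θs θss, μ ≤ pot d β θ - E := by
  have hb := Real.sqrt_pos.2 hβ
  rw [Ham_eq P.left_mem] at hs
  rw [Ham_eq P.right_mem] at hss
  have h1 : 0 ≤ α * √β / √(distSq d β θs 0) := by positivity
  have h2 : 0 ≤ α * √β / √(distSq d β θss 0) := by positivity
  refine ⟨min (pot d β θs) (pot d β θss) - E, ?_, fun θ hθ => ?_⟩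
  · exact sub_pos.2 (lt_min (by linarith) (by linarith))
  · exact sub_le_sub_right ((pot_concaveOn hβ hd).min_le_of_mem_Icc P.left_mem P.right_mem hθ) E

/-- Below the energy of both equilibria, a point whose energy is at most `E` does not lie on the
lines `θ = θs` and `θ = θss`. -/
theorem ne_of_Ham_le (hα : 0 < α) (hβ : 0 < β) (hd : 0 < d) (hs : E < Ham α β d θs 0)
    (hss : E < Ham α β d θss 0) (h : Ham α β d θ W ≤ E) : θ ≠ θs ∧ θ ≠ θss := by
  constructor
  · rintro rfl
    exact absurd (Ham_axis_le hα hβ hd P.left_mem P.lt_thetaB.ne W) (by linarith)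
  · rintro rfl
    exact absurd (Ham_axis_le hα hβ hd P.right_mem P.thetaB_lt.ne' W) (by linarith)

theorem notMem_equilibria (hα : 0 < α) (hβ : 0 < β) (hd : 0 < d) (hs : E < Ham α β d θs 0)
    (hss : E < Ham α β d θss 0) (h : Ham α β d θ W = E) : (θ, W) ∉ equilibria α β d := by
  rw [P.equilibria_eq hα hβ hd]
  obtain ⟨h1, h2⟩ := P.ne_of_Ham_le hα hβ hd hs hss h.le
  rintro (e | e)
  · exact h1 (Prod.mk.inj e).1
  · exact h2 (Prod.mk.inj e).1

section Orbit

variable {p₀ : ℝ × ℝ} {γ : ℝ → ℝ × ℝ}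

/-- An orbit between `θs` and `θss`, of energy below both equilibria, meets the axis `W = 0` at
arbitrarily late times: otherwise `θ` would be eventually monotone and the orbit would converge to
an equilibrium of the same energy. -/
theorem exists_snd_eq_zero (hα : 0 < α) (hβ : 0 < β) (hd : 0 < d) (S : IsSolution α β d p₀ γ)
    (hs : Ham α β d p₀.1 p₀.2 < Ham α β d θs 0) (hss : Ham α β d p₀.1 p₀.2 < Ham α β d θss 0)
    (hθ : ∀ t, (γ t).1 ∈ Ioo θs θss) (t₀ : ℝ) : ∃ t > t₀, (γ t).2 = 0 := by
  by_contra! hne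
  set E := Ham α β d p₀.1 p₀.2 with hE
  have hb := Real.sqrt_pos.2 hβ
  have hcW : Continuous fun t => (γ t).2 := continuous_snd.comp S.continuous
  have hF1 : ∀ t, F1 α β d (γ t).1 (γ t).2
      = α * √β / √(distSq d β (γ t).1 (γ t).2) ^ 3 * (γ t).2 := fun t => by
    rw [F1_eq hβ]; ring
  obtain ⟨μ, hμ, hpot⟩ := P.exists_lt_pot_sub hα hβ hd hs hss
  -- It suffices that `θ` and the sign `ε` of `W` converge.
  suffices key : ∃ L ε : ℝ, Tendsto (fun t => (γ t).1) atTop (𝓝 L) ∧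
      ∀ᶠ t in atTop, (γ t).2 = ε * √((γ t).2 ^ 2) ∧ ε ^ 2 = 1 by
    obtain ⟨L, ε, hL, hε⟩ := key
    have hε1 : ε ^ 2 = 1 := by
      obtain ⟨t, ht⟩ := hε.exists
      exact ht.2
    have hLI : L ∈ Icc θs θss :=
      isClosed_Icc.mem_of_tendsto hL (Eventually.of_forall fun t => Ioo_subset_Icc_self (hθ t))
    have hLI' := P.mem_Ioo_of_mem_Icc hLI
    have hpL := hpot L hLI
    set w := (α * √β / (pot d β L - E)) ^ 2 - sep d β L ^ 2 with hw
    have hW2 : Tendsto (fun t => (γ t).2 ^ 2) atTop (𝓝 w) := by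
      simp_rw [fun t => sq_eq_of_Ham_eq hα hβ hd (S.mem_Omega t) (S.Ham_eq hβ hd t)]
      have h1 := (hasDerivAt_pot β hd hLI').continuousAt.tendsto.comp hL
      have h2 := (continuous_sep d β).continuousAt.tendsto.comp hL
      exact ((tendsto_const_nhds.div (h1.sub_const E) (by linarith)).pow 2).sub (h2.pow 2)
    have hw0 : 0 ≤ w := ge_of_tendsto' hW2 fun t => sq_nonneg _
    have hW : Tendsto (fun t => (γ t).2) atTop (𝓝 (ε * √w)) := by
      refine (hW2.sqrt.const_mul ε).congr' ?_
      filter_upwards [hε] with t ht using ht.1.symm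
    have hA : 0 < α * √β / (pot d β L - E) := div_pos (by positivity) (by linarith)
    have hdist : √(distSq d β L (ε * √w)) = α * √β / (pot d β L - E) := by
      rw [distSq_eq hβ, mul_pow, hε1, one_mul, Real.sq_sqrt hw0, hw, add_sub_cancel,
        Real.sqrt_sq hA.le]
    have hΩ : (L, ε * √w) ∈ Omega β := by
      refine ⟨hLI'.1, hLI'.2, fun e => ?_⟩
      obtain ⟨e1, e2⟩ := Prod.mk.inj e
      rw [e2, distSq_eq hβ, e1, sep_thetaB hβ, zero_pow two_ne_zero, add_zero,
        Real.sqrt_zero] at hdist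
      rw [e1] at hA
      exact hA.ne hdist
    refine P.notMem_equilibria hα hβ hd hs hss ?_
      (S.mem_equilibria_of_tendsto hβ hd hΩ (hL.prodMk_nhds hW))
    rw [Ham_eq_iff hβ hd hΩ, hdist, div_mul_cancel₀ _ (by linarith)]
  rcases lt_or_gt_of_ne (hne (t₀ + 1) (by linarith)) with hneg | hpos
  · have hW : ∀ t, t₀ < t → (γ t).2 < 0 := by
      intro t ht
      by_contra h
      obtain ⟨u, hu, hu'⟩ := (isPreconnected_Ioi (a := t₀)).intermediate_value
        (show t₀ + 1 ∈ Ioi t₀ from lt_add_one t₀) ht hcW.continuousOn ⟨hneg.le, not_lt.1 h⟩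
      exact hne u hu hu'
    obtain ⟨L, hL⟩ := exists_tendsto_of_deriv_nonneg (a := t₀) (M := -θs)
      (fun t => (S.hasDerivAt_fst t).neg)
      (fun t ht => by
        rw [hF1, neg_nonneg]
        exact mul_nonpos_of_nonneg_of_nonpos (by positivity) (hW t ht).le)
      (fun t => neg_le_neg (hθ t).1.le)
    refine ⟨-L, -1, by simpa using hL.neg, ?_⟩
    filter_upwards [eventually_gt_atTop t₀] with t ht
    rw [Real.sqrt_sq_eq_abs, abs_of_neg (hW t ht)]
    norm_num
  · have hW : ∀ t, t₀ < t → 0 < (γ t).2 := by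
      intro t ht
      by_contra h
      obtain ⟨u, hu, hu'⟩ := (isPreconnected_Ioi (a := t₀)).intermediate_value ht
        (show t₀ + 1 ∈ Ioi t₀ from lt_add_one t₀) hcW.continuousOn ⟨not_lt.1 h, hpos.le⟩
      exact hne u hu hu'
    obtain ⟨L, hL⟩ := exists_tendsto_of_deriv_nonneg (a := t₀) (M := θss) S.hasDerivAt_fst
      (fun t ht => by
        rw [hF1]
        exact mul_nonneg (by positivity) (hW t ht).le)
      (fun t => (hθ t).2.le)
    refine ⟨L, 1, hL, ?_⟩
    filter_upwards [eventually_gt_atTop t₀] with t ht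
    rw [Real.sqrt_sq (hW t ht).le]
    norm_num

/-- An orbit between `θs` and `θss`, of energy below both equilibria, is a closed orbit and fills
its energy level between the lines `θ = θs` and `θ = θss`. -/
theorem isClosedOrbit_and_subset_range (hα : 0 < α) (hβ : 0 < β) (hd : 0 < d)
    (S : IsSolution α β d p₀ γ) (hs : Ham α β d p₀.1 p₀.2 < Ham α β d θs 0)
    (hss : Ham α β d p₀.1 p₀.2 < Ham α β d θss 0) (hθ : ∀ t, (γ t).1 ∈ Ioo θs θss) :
    IsClosedOrbit γ ∧ ∀ θ W, (θ, W) ∈ Omega β → θ ∈ Ioo θs θss →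
      Ham α β d θ W = Ham α β d p₀.1 p₀.2 → (θ, W) ∈ range γ := by
  set E := Ham α β d p₀.1 p₀.2 with hE
  have hHam : ∀ t, Ham α β d (γ t).1 (γ t).2 = E := S.Ham_eq hβ hd
  have hcθ : Continuous fun t => (γ t).1 := continuous_fst.comp S.continuous
  obtain ⟨c₁, -, hc₁⟩ := P.exists_snd_eq_zero hα hβ hd S hs hss hθ 0
  obtain ⟨c₂, hc, hc₂⟩ := P.exists_snd_eq_zero hα hβ hd S hs hss hθ c₁
  have hT : 0 < 2 * (c₂ - c₁) := by linarith
  have hper := S.periodic_of_snd_eq_zero hβ hd hc₁ hc₂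
  have hcomp := hper.compact_of_continuous hT.ne' S.continuous
  obtain ⟨_, ⟨tM, rfl⟩, hM⟩ := hcomp.exists_isMaxOn (range_nonempty γ) continuous_fst.continuousOn
  obtain ⟨_, ⟨tm, rfl⟩, hm⟩ := hcomp.exists_isMinOn (range_nonempty γ) continuous_fst.continuousOn
  replace hM : ∀ t, (γ t).1 ≤ (γ tM).1 := fun t => hM (mem_range_self t)
  replace hm : ∀ t, (γ tm).1 ≤ (γ t).1 := fun t => hm (mem_range_self t)
  -- At the extrema of `θ` the orbit crosses the axis.
  have hWM : (γ tM).2 = 0 := (F1_eq_zero_iff hα hβ hd (S.mem_Omega tM)).1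
    (IsLocalMax.hasDerivAt_eq_zero (Eventually.of_forall hM) (S.hasDerivAt_fst tM))
  have hWm : (γ tm).2 = 0 := (F1_eq_zero_iff hα hβ hd (S.mem_Omega tm)).1
    (IsLocalMin.hasDerivAt_eq_zero (Eventually.of_forall hm) (S.hasDerivAt_fst tm))
  have hlt : (γ tm).1 < (γ tM).1 := by
    refine (hm tM).lt_of_ne fun heq => ?_
    have hconst : ∀ t, (γ t).1 = (γ tM).1 := fun t => le_antisymm (hM t) (heq ▸ hm t)
    have h1 : ∀ t, F1 α β d (γ t).1 (γ t).2 = 0 := fun t => by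
      refine (S.hasDerivAt_fst t).unique ?_
      simp_rw [hconst]
      exact hasDerivAt_const _ _
    have h2 : F2 α β d (γ tM).1 (γ tM).2 = 0 := by
      have hW : ∀ t, (γ t).2 = 0 := fun t => (F1_eq_zero_iff hα hβ hd (S.mem_Omega t)).1 (h1 t)
      refine (S.hasDerivAt_snd tM).unique ?_
      simp_rw [hW]
      exact hasDerivAt_const _ _
    exact P.notMem_equilibria hα hβ hd hs hss (hHam tM) ⟨S.mem_Omega tM, h1 tM, h2⟩
  have hEM : Ham α β d (γ tM).1 0 = E := by rw [← hHam tM, hWM]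
  have hEm : Ham α β d (γ tm).1 0 = E := by rw [← hHam tm, hWm]
  have hneM : (γ tM).1 ≠ thetaB β := fun e => (S.mem_Omega tM).2.2 (Prod.ext e hWM)
  have hnem : (γ tm).1 ≠ thetaB β := fun e => (S.mem_Omega tm).2.2 (Prod.ext e hWm)
  -- The Hamiltonian on the axis is injective on either side of `θ_β`.
  have hM' : thetaB β < (γ tM).1 := by
    by_contra h
    have h' := (not_lt.1 h).lt_of_ne hneM
    exact absurd (P.Ham_strictAntiOn_left hβ hd ⟨(hθ tm).1.le, hlt.trans h'⟩
      ⟨(hθ tM).1.le, h'⟩ hlt) (by simp only [hEM, hEm, lt_irrefl, not_false_eq_true])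
  have hm' : (γ tm).1 < thetaB β := by
    by_contra h
    have h' := (not_lt.1 h).lt_of_ne' hnem
    exact absurd (P.Ham_strictMonoOn_right hβ hd ⟨h', (hθ tm).2.le⟩
      ⟨h'.trans hlt, (hθ tM).2.le⟩ hlt) (by simp only [hEM, hEm, lt_irrefl, not_false_eq_true])
  refine ⟨⟨⟨_, hT, hper⟩, tm, tM, fun e => hlt.ne (congrArg Prod.fst e)⟩,
    fun θ W hΩ hθI hHE => ?_⟩
  have hI : (γ tm).1 ≤ θ ∧ θ ≤ (γ tM).1 := by
    by_cases hB : θ = thetaB β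
    · rw [hB]; exact ⟨hm'.le, hM'.le⟩
    have hax := (Ham_axis_le hα hβ hd (mem_Ioo_of_mem_Omega hΩ) hB W).trans_eq hHE
    rcases lt_or_gt_of_ne hB with h | h
    · exact ⟨((P.Ham_strictAntiOn_left hβ hd).le_iff_ge ⟨hθI.1.le, h⟩ ⟨(hθ tm).1.le, hm'⟩).1
        (hax.trans_eq hEm.symm), (h.trans hM').le⟩
    · exact ⟨(hm'.trans h).le, ((P.Ham_strictMonoOn_right hβ hd).le_iff_le ⟨h, hθI.2.le⟩
        ⟨hM', (hθ tM).2.le⟩).1 (hax.trans_eq hEM.symm)⟩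
  obtain ⟨t, rfl⟩ := mem_range_of_exists_le_of_exists_ge hcθ ⟨tm, hI.1⟩ ⟨tM, hI.2⟩
  have hsq := (sq_eq_of_Ham_eq hα hβ hd hΩ hHE).trans
    (sq_eq_of_Ham_eq hα hβ hd (S.mem_Omega t) (hHam t)).symm
  rcases sq_eq_sq_iff_eq_or_eq_neg.1 hsq with rfl | rfl
  · exact ⟨t, rfl⟩
  · exact ⟨2 * c₁ - t, S.symm_of_snd_eq_zero hβ hd hc₁ t⟩

/-- If the orbit fills its energy level between `θs` and `θss`, it encloses `(θ_β, 0)`: the points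
of smaller energy form a bounded neighbourhood of `(θ_β, 0)` with boundary in the orbit. -/
theorem encloses (hα : 0 < α) (hβ : 0 < β) (hd : 0 < d) (S : IsSolution α β d p₀ γ)
    (hs : E < Ham α β d θs 0) (hss : E < Ham α β d θss 0)
    (hr : ∀ θ W, (θ, W) ∈ Omega β → θ ∈ Ioo θs θss → Ham α β d θ W = E → (θ, W) ∈ range γ) :
    Encloses γ (thetaB β, 0) := by
  have hb := Real.sqrt_pos.2 hβ
  have hA : 0 < α * √β := by positivity
  have hc : (thetaB β, (0 : ℝ)) ∉ range γ := by
    rintro ⟨t, ht⟩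
    exact (S.mem_Omega t).2.2 ht
  refine ⟨hc, ?_⟩
  obtain ⟨μ, hμ, hpot⟩ := P.exists_lt_pot_sub hα hβ hd hs hss
  let g : ℝ × ℝ → ℝ := fun p => √(distSq d β p.1 p.2) * (pot d β p.1 - E)
  have hg : ContinuousOn g (Prod.fst ⁻¹' Icc θs θss) := by
    refine ContinuousOn.mul (Continuous.continuousOn (by unfold distSq; fun_prop)) ?_
    refine ContinuousOn.sub (fun p hp => ?_) continuousOn_const
    exact ((hasDerivAt_pot β hd (P.mem_Ioo_of_mem_Icc hp)).continuousAt.comp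
      continuousAt_fst).continuousWithinAt
  have hD : IsOpen (Prod.fst ⁻¹' Ioo θs θss ∩ g ⁻¹' Iio (α * √β)) :=
    (hg.mono (preimage_mono Ioo_subset_Icc_self)).isOpen_inter_preimage
      (isOpen_Ioo.preimage continuous_fst) isOpen_Iio
  have hD' : IsClosed (Prod.fst ⁻¹' Icc θs θss ∩ g ⁻¹' Iic (α * √β)) :=
    hg.preimage_isClosed_of_isClosed (isClosed_Icc.preimage continuous_fst) isClosed_Iic
  have hcD : (thetaB β, (0 : ℝ)) ∈ Prod.fst ⁻¹' Ioo θs θss ∩ g ⁻¹' Iio (α * √β) := by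
    refine ⟨⟨P.lt_thetaB, P.thetaB_lt⟩, ?_⟩
    change √(distSq d β (thetaB β) 0) * _ < _
    rw [distSq_eq hβ, sep_thetaB hβ]
    simpa using hA
  have hsub : connectedComponentIn (range γ)ᶜ (thetaB β, 0)
      ⊆ Prod.fst ⁻¹' Ioo θs θss ∩ g ⁻¹' Iio (α * √β) := by
    refine isPreconnected_connectedComponentIn.subset_of_closure_inter_subset hD
      ⟨_, mem_connectedComponentIn hc, hcD⟩ ?_
    rintro ⟨θ, W⟩ ⟨hcl, hcc⟩
    have hnr := connectedComponentIn_subset _ _ hcc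
    obtain ⟨hθ, hgle⟩ := closure_minimal
      (inter_subset_inter (preimage_mono Ioo_subset_Icc_self) (preimage_mono Iio_subset_Iic_self))
      hD' hcl
    by_cases hp : (θ, W) = (thetaB β, 0)
    · rw [hp]; exact hcD
    have hθ' := P.mem_Ioo_of_mem_Icc hθ
    have hΩ : (θ, W) ∈ Omega β := ⟨hθ'.1, hθ'.2, hp⟩
    have hle : Ham α β d θ W ≤ E := (Ham_le_iff hβ hd hΩ).2 hgle
    obtain ⟨h1, h2⟩ := P.ne_of_Ham_le hα hβ hd hs hss hle
    have hI : θ ∈ Ioo θs θss := ⟨hθ.1.lt_of_ne' h1, hθ.2.lt_of_ne h2⟩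
    refine ⟨hI, lt_of_le_of_ne hgle fun heq => hnr (hr θ W hΩ hI ((Ham_eq_iff hβ hd hΩ).2 heq))⟩
  refine (isBounded_Icc (θs, -(α * √β / μ)) (θss, α * √β / μ)).subset (hsub.trans ?_)
  rintro ⟨θ, W⟩ ⟨hθ, hlt⟩
  have hW : |W| ≤ α * √β / μ := by
    have h1 : |W| ≤ √(distSq d β θ W) := by
      refine Real.abs_le_sqrt ?_
      rw [distSq_eq hβ]; nlinarith
    have h2 := hpot θ (Ioo_subset_Icc_self hθ)
    rw [le_div_iff₀ hμ]
    calc |W| * μ ≤ √(distSq d β θ W) * (pot d β θ - E) := by gcongr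
      _ ≤ α * √β := le_of_lt hlt
  exact ⟨⟨hθ.1.le, (abs_le.1 hW).1⟩, ⟨hθ.2.le, (abs_le.1 hW).2⟩⟩

end Orbit

end IsCriticalPair

section Rays

variable {γ : ℝ → ℝ × ℝ} {c : ℝ × ℝ}

/-- A curve that encloses a point meets every connected unbounded set through that point. -/
theorem Encloses.exists_mem (h : Encloses γ c) {R : Set (ℝ × ℝ)} (hR : IsPreconnected R)
    (hcR : c ∈ R) (hub : ¬ Bornology.IsBounded R) : ∃ t, γ t ∈ R := by
  by_contra! hne
  refine hub (h.2.subset (hR.subset_connectedComponentIn hcR ?_))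
  rintro _ hx ⟨t, rfl⟩
  exact hne t hx

theorem Encloses.exists_right (h : Encloses γ c) : ∃ t, c.1 < (γ t).1 ∧ (γ t).2 = c.2 := by
  obtain ⟨t, ht1, ht2⟩ := h.exists_mem (R := Ici c.1 ×ˢ {c.2})
    (isPreconnected_Ici.prod isPreconnected_singleton) ⟨by simp, rfl⟩ fun hb => by
      have := hb.image_fst
      rw [fst_image_prod _ (singleton_nonempty _)] at this
      exact not_bddAbove_Ici _ this.bddAbove
  refine ⟨t, lt_of_le_of_ne ht1 fun e => h.1 ⟨t, Prod.ext e.symm ht2⟩, ht2⟩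

theorem Encloses.exists_left (h : Encloses γ c) : ∃ t, (γ t).1 < c.1 ∧ (γ t).2 = c.2 := by
  obtain ⟨t, ht1, ht2⟩ := h.exists_mem (R := Iic c.1 ×ˢ {c.2})
    (isPreconnected_Iic.prod isPreconnected_singleton) ⟨by simp, rfl⟩ fun hb => by
      have := hb.image_fst
      rw [fst_image_prod _ (singleton_nonempty _)] at this
      exact not_bddBelow_Iic _ this.bddBelow
  refine ⟨t, lt_of_le_of_ne ht1 fun e => h.1 ⟨t, Prod.ext e ht2⟩, ht2⟩

end Rays

theorem IsCriticalPair.isLeapfrogging_iff {α β d θs θss θ₀ W₀ : ℝ} {γ : ℝ → ℝ × ℝ}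
    (P : IsCriticalPair α β d θs θss) (hα : 0 < α) (hβ : 0 < β) (hd : 0 < d)
    (S : IsSolution α β d (θ₀, W₀) γ) :
    IsLeapfrogging β γ ↔ θ₀ ∈ Ioo θs θss ∧
      Ham α β d θ₀ W₀ < min (Ham α β d θs 0) (Ham α β d θss 0) := by
  have hHam : ∀ t, Ham α β d (γ t).1 (γ t).2 = Ham α β d θ₀ W₀ := S.Ham_eq hβ hd
  have hcθ : Continuous fun t => (γ t).1 := continuous_fst.comp S.continuous
  constructor
  · rintro ⟨⟨-, s, t, hst⟩, henc⟩
    obtain ⟨t₁, h1, h1'⟩ := henc.exists_right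
    obtain ⟨t₂, h2, h2'⟩ := henc.exists_left
    dsimp only at h1 h1' h2 h2'
    have hneq : ∀ u, γ u ∉ equilibria α β d := fun u hu => hst <| by
      rw [S.const_of_mem_equilibria hβ hd hu s, S.const_of_mem_equilibria hβ hd hu t]
    rw [P.equilibria_eq hα hβ hd] at hneq
    have hss : Ham α β d θ₀ W₀ < Ham α β d θss 0 := by
      rw [← hHam t₁, h1']
      exact P.Ham_lt_right hβ hd ⟨h1, (S.mem_Omega t₁).2.1⟩
        fun e => hneq t₁ (Or.inr (Prod.ext e h1'))
    have hs : Ham α β d θ₀ W₀ < Ham α β d θs 0 := by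
      rw [← hHam t₂, h2']
      exact P.Ham_lt_left hβ hd ⟨(S.mem_Omega t₂).1, h2⟩
        fun e => hneq t₂ (Or.inl (Prod.ext e h2'))
    have hne := fun t => P.ne_of_Ham_le hα hβ hd hs hss (hHam t).le
    have h0 : (γ 0).1 = θ₀ := by rw [S.init]
    refine ⟨⟨?_, ?_⟩, lt_min hs hss⟩
    · exact h0 ▸ lt_of_forall_ne hcθ (fun t => (hne t).1) (P.lt_thetaB.trans h1) 0
    · exact h0 ▸ gt_of_forall_ne hcθ (fun t => (hne t).2) (h2.trans P.thetaB_lt) 0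
  · rintro ⟨hI, hlt⟩
    obtain ⟨hs, hss⟩ := lt_min_iff.1 hlt
    have hne := fun t => P.ne_of_Ham_le hα hβ hd hs hss (hHam t).le
    have h0 : (γ 0).1 ∈ Ioo θs θss := by rwa [S.init]
    have hθ : ∀ t, (γ t).1 ∈ Ioo θs θss := fun t =>
      ⟨lt_of_forall_ne hcθ (fun t => (hne t).1) h0.1 t,
        gt_of_forall_ne hcθ (fun t => (hne t).2) h0.2 t⟩
    obtain ⟨hcl, hr⟩ := P.isClosedOrbit_and_subset_range hα hβ hd S hs hss hθ
    exact ⟨hcl, P.encloses hα hβ hd S hs hss hr⟩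

end FilamentPair

theorem theorem2 (α β d : ℝ) (hα : 0 < α) (hα' : α < 1 / 3) (hβ : 1 ≤ β) (hd : 0 < d) :
    ∃ θs θss : ℝ,
      0 < θs ∧ θs < FilamentPair.thetaB β ∧
      FilamentPair.thetaB β < θss ∧ θss < Real.pi / 2 ∧
      FilamentPair.equilibria α β d = {(θs, 0), (θss, 0)} ∧
      ∀ θ₀ W₀ : ℝ, (θ₀, W₀) ∈ FilamentPair.Omega β →
        (∃! γ : ℝ → ℝ × ℝ, FilamentPair.IsSolution α β d (θ₀, W₀) γ) ∧
        ∀ γ : ℝ → ℝ × ℝ, FilamentPair.IsSolution α β d (θ₀, W₀) γ →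
          (FilamentPair.IsLeapfrogging β γ ↔
            θ₀ ∈ Set.Ioo θs θss ∧
            FilamentPair.Ham α β d θ₀ W₀ <
              min (FilamentPair.Ham α β d θs 0) (FilamentPair.Ham α β d θss 0)) := by
  have hβ' : 0 < β := by linarith
  obtain ⟨θs, θss, P⟩ := FilamentPair.exists_isCriticalPair hα hβ' hd
  exact ⟨θs, θss, P.pos, P.lt_thetaB, P.thetaB_lt, P.lt_pi_div_two, P.equilibria_eq hα hβ' hd,
    fun θ₀ W₀ h => ⟨FilamentPair.existsUnique_isSolution hα hβ' hd h,
      fun γ S => P.isLeapfrogging_iff hα hβ' hd S⟩⟩
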